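/- Let $N\ge 2$ be an integer and let $\Omega_N=\{\mathbf x=(x_1,x_2,\dots): x_i\in\mathbb Z_N,\ x_i=0 \text{ for all but finitely many } i\}$ be the hierarchical group of order $N$, with the ultrametric $d(\mathbf x,\mathbf y)=\max\{i: x_i\ne y_i\}$ for $\mathbf x\ne\mathbf y$ and $d(\mathbf x,\mathbf x)=0$. Let $B_k(\mathbf 0)=\{\mathbf y: d(\mathbf 0,\mathbf y)\le k\}$, which has $N^k$ points. Let $\alpha>0$, let $C_0,C_1\ge 0$ and $C_2>0$, and put $c_k=C_0+C_1\log k+C_2k^\alpha$ for $k\ge1$. Consider the random graph with vertex set $\Omega_N$ in which two distinct points $\mathbf x,\mathbf y$ with $d(\mathbf x,\mathbf y)=k$ are joined by an edge with probability $\min(c_k/N^{2k},1)$, independently for all pairs. A percolation cluster is an infinite connected component of this graph, and the density of a set $S\subseteq\Omega_N$ is $\lim_{k\to\infty}|S\cap B_k(\mathbf 0)|/N^k$ when this limit exists. There is a constant $C^*=C^*(N,\alpha)$ such that for every $C_2\ge C^*$ with $C_2>0$ there is $\varepsilon=\varepsilon(N,C_2,\alpha)>0$ such that, for all $C_0,C_1\ge0$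 (in particular for $C_0=C_1=0$): almost surely there is exactly one percolation cluster, its density exists, and its density is at least $\varepsilon$; and the origin $\mathbf 0=(0,0,\dots)$ belongs to the percolation cluster with positive probability. -/

import Mathlib

open MeasureTheory ProbabilityTheory Filter Topology

noncomputable section

namespace HierarchicalPercolation

/-- The hierarchical group `Ω_N`: finitely supported sequences in `ℤ / N`, added componentwise.
The coordinate with index `i : ℕ` is the one usually written `x_{i+1}`. -/
abbrev HierGroup (N : ℕ) : Type := ℕ →₀ ZMod N

/-- The hierarchical distance: `0` if `x = y`, and otherwise the largest (1-based) index of a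
coordinate at which `x` and `y` differ. -/
def hdist {N : ℕ} (x y : HierGroup N) : ℕ := (x.neLocus y).sup (fun i => i + 1)

theorem hdist_comm {N : ℕ} (x y : HierGroup N) : hdist x y = hdist y x := by
  rw [hdist, hdist, Finsupp.neLocus_comm]

/-- The hierarchical distance as a function of the unordered pair of endpoints. -/
def edgeLength {N : ℕ} : Sym2 (HierGroup N) → ℕ :=
  Sym2.lift ⟨hdist, hdist_comm⟩

/-- The ball of diameter `k` around `x`. -/
def ball {N : ℕ} (x : HierGroup N) (k : ℕ) : Set (HierGroup N) := {y | hdist x y ≤ k}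

/-- The connection constants `c_k = C₀ + C₁ log k + C₂ k ^ α`. -/
def connConst (C₀ C₁ C₂ α : ℝ) (k : ℕ) : ℝ :=
  C₀ + C₁ * Real.log k + C₂ * (k : ℝ) ^ α

/-- The connection probability `min (c_k / N ^ (2 k), 1)` of two points at distance `k ≥ 1`.
(`Set.projIcc` also truncates at `0`, which plays no role for nonnegative `c_k`.) -/
def connProb (N : ℕ) (c : ℕ → ℝ) (k : ℕ) : unitInterval :=
  Set.projIcc 0 1 zero_le_one (c k / (N : ℝ) ^ (2 * k))

/-- Configurations: each unordered pair of points is open (`true`) or closed (`false`). The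
states of the diagonal pairs are ignored by the random graph below. -/
abbrev Config (N : ℕ) : Type := Sym2 (HierGroup N) → Bool

/-- The law of the configuration: all pairs are independent, and a pair of points at distance
`k` is open with probability `connProb N c k`. -/
def percMeasure (N : ℕ) (c : ℕ → ℝ) : Measure (Config N) :=
  Measure.infinitePi fun e => bernoulliMeasure true false (connProb N c (edgeLength e))

/-- The random graph: two distinct points are adjacent iff their pair is open. -/
def randomGraph {N : ℕ} (ω : Config N) : SimpleGraph (HierGroup N) where
  Adj x y := x ≠ y ∧ ω s(x, y) = true
  symm := ⟨fun _ _ h => ⟨h.1.symm, by rw [Sym2.eq_swap]; exact h.2⟩⟩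
  loopless := ⟨fun _ h => h.1 rfl⟩

/-- A percolation cluster of the graph `G`: (the vertex set of) an infinite connected
component of `G`. -/
def IsPercolationCluster {V : Type} (G : SimpleGraph V) (S : Set V) : Prop :=
  S.Infinite ∧ ∃ C : G.ConnectedComponent, C.supp = S

/-- The set `S` has density `d` in `Ω_N`: the proportion of the points of the `k`-ball around
the origin that lie in `S` tends to `d`. (For every `x`, the `k`-ball around `x` is the `k`-ball
around the origin as soon as `k ≥ hdist 0 x`, so the centre does not matter.) -/
def HasDensity {N : ℕ} (S : Set (HierGroup N)) (d : ℝ) : Prop :=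
  Tendsto (fun k : ℕ => ((S ∩ ball 0 k).ncard : ℝ) / (N : ℝ) ^ k) atTop (𝓝 d)

end HierarchicalPercolation

end

/-!
The proof is a renormalisation with one level per step. Call all points alive at level `0`, and let
the points alive at level `k` in a ball of diameter `k + 1` stay alive at level `k + 1` if the ball
is *good*: its `N` subballs of diameter `k` are linked to each other by open edges between alive
points, and at least one eighth of the points of the ball is alive. Otherwise all points of the ball
die. The alive points of a ball of diameter `k` are connected inside the ball, and there are either
none of them or at least `N ^ k / 8`; hence the subballs of a ball fail to be linked with
probability at most `linkError N c k = N ^ 2 * exp (-c (k + 1) / (64 * N ^ 2))`. The densities of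
alive points in the subballs are independent, so averaging over them divides the variance by `N`;
by Chebyshev's inequality the ball is unlikely to have a low density, and if it does, killing its
points costs little. This gives the recursion `variance_aliveDensity_succ_le`, whose solution is
summable. If `∑ k, linkError N c k ≤ 1 / 128`, which holds once `C₂` is large, then a given point is
alive at any level with probability at least `7 / 8`, and almost surely all large balls around the
origin are good (`ae_eventually_good`). In this case the alive points of these balls lie in one
cluster of lower density at least `1 / 8`, and the origin is alive at all levels with positive
probability.

Uniqueness: let `x` have an infinite cluster. For each `n` there is an open edge from a point that
is connected to `x` inside the `n`-ball of the origin to a point `z` outside this ball. Given the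
states of all pairs that touch the `n`-ball, the point `z` is dead at the level of the largest ball
around `z` that avoids the origin with probability at most `1 / 8`
(`measure_missSet_inter_le`), and if it is alive, then it lies in the cluster constructed above when
`n` is large. By Lévy's zero-one law the exits of the cluster of `x` cannot all miss the alive
points for every large `n` (`ae_exists_notMem_missSet`).

Existence of the density: the ball of diameter `k` around the origin is a finite group that acts on
configurations by measure-preserving translations, and the proportion of its points whose cluster is
infinite is the average of the event "the origin has an infinite cluster" over this group. Averages
over an increasing sequence of finite groups converge almost surely (`GroupAverage.ae_tendsto_avg`):
this is the convergence of a reversed martingale, proved here by orthogonality in `L²` and a maximal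
inequality.
-/

noncomputable section

/-! ### Two conditioning lemmas -/

/-- If every point of `W` lies in some `O i`, and in `D i` for each such `i`, where `D i` has
conditional probability at most `c` on `O i` given the information `m₁` that reveals the `O i`,
then `W` has conditional probability at most `c` given `m₁`: condition on the first `i` for which
`O i` occurs. -/
theorem MeasureTheory.measure_inter_le_mul_of_cover {Ω ι : Type*} {m₁ m₀ : MeasurableSpace Ω}
    (hm : m₁ ≤ m₀) {μ : Measure Ω} [Countable ι] {O D : ι → Set Ω} {c : ENNReal}
    (hO : ∀ i, MeasurableSet[m₁] (O i))
    (hD : ∀ i E, MeasurableSet[m₁] E → E ⊆ O i → μ (E ∩ D i) ≤ c * μ E) {W : Set Ω}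
    (hcov : W ⊆ ⋃ i, O i) (hW : ∀ i, W ∩ O i ⊆ D i) {E : Set Ω} (hE : MeasurableSet[m₁] E) :
    μ (W ∩ E) ≤ c * μ E := by
  rcases isEmpty_or_nonempty ι with hι | hι
  · have : W = ∅ := by simpa using hcov
    simp [this]
  obtain ⟨e, he⟩ := exists_surjective_nat ι
  set O' : ℕ → Set Ω := fun n => O (e n) with hO'
  have hdm : ∀ n, MeasurableSet[m₁] (disjointed O' n) := fun n =>
    MeasurableSet.disjointed (fun i => hO (e i)) n
  have hsub : W ∩ E ⊆ ⋃ n, (E ∩ disjointed O' n) ∩ D (e n) := by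
    rintro ω ⟨hω, hωE⟩
    have h1 : ω ∈ ⋃ n, disjointed O' n := by
      rw [iUnion_disjointed]
      obtain ⟨i, hi⟩ := Set.mem_iUnion.1 (hcov hω)
      obtain ⟨n, rfl⟩ := he i
      exact Set.mem_iUnion.2 ⟨n, hi⟩
    obtain ⟨n, hn⟩ := Set.mem_iUnion.1 h1
    exact Set.mem_iUnion.2 ⟨n, ⟨hωE, hn⟩, hW (e n) ⟨hω, disjointed_subset O' n hn⟩⟩
  have hdisj : Pairwise (Function.onFun Disjoint fun n => E ∩ disjointed O' n) := fun i j hij =>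
    (disjoint_disjointed O' hij).mono Set.inter_subset_right Set.inter_subset_right
  calc μ (W ∩ E) ≤ ∑' n, μ ((E ∩ disjointed O' n) ∩ D (e n)) :=
        (measure_mono hsub).trans (measure_iUnion_le _)
    _ ≤ ∑' n, c * μ (E ∩ disjointed O' n) := ENNReal.tsum_le_tsum fun n =>
        hD (e n) _ (MeasurableSet.inter hE (hdm n))
          (Set.inter_subset_right.trans (disjointed_subset O' n))
    _ = c * μ (⋃ n, E ∩ disjointed O' n) := by
        rw [ENNReal.tsum_mul_left,
          measure_iUnion hdisj fun n => hm _ (MeasurableSet.inter hE (hdm n))]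
    _ ≤ c * μ E := by
        gcongr
        exact Set.iUnion_subset fun n => Set.inter_subset_left

/-- Lévy's zero-one law: an event whose conditional probability given `ℱ n` stays below a constant
less than one is null. -/
theorem MeasureTheory.measure_eq_zero_of_inter_le {Ω : Type*} {m₀ : MeasurableSpace Ω}
    {μ : Measure Ω} [IsProbabilityMeasure μ] (ℱ : Filtration ℕ m₀) (hℱ : ⨆ n, ℱ n = m₀)
    {W : Set Ω} (hW : MeasurableSet W) {a : ℝ} (ha0 : 0 ≤ a) (ha1 : a < 1) {n₀ : ℕ}
    (h : ∀ n, n₀ ≤ n → ∀ E, MeasurableSet[ℱ n] E → μ.real (W ∩ E) ≤ a * μ.real E) :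
    μ W = 0 := by
  have hint : Integrable (W.indicator (1 : Ω → ℝ)) μ :=
    (integrable_indicator_iff hW).2 (integrable_const 1).integrableOn
  have hle : ∀ n, n₀ ≤ n → ∀ᵐ ω ∂μ, μ[W.indicator (1 : Ω → ℝ) | ℱ n] ω ≤ a := by
    intro n hn
    rw [ae_iff]
    simp only [not_le]
    by_contra hne
    have hE : MeasurableSet[ℱ n] {ω | a < μ[W.indicator (1 : Ω → ℝ) | ℱ n] ω} :=
      stronglyMeasurable_const.measurableSet_lt stronglyMeasurable_condExp
    have h1 := setIntegral_gt_gt ha0 integrable_condExp.integrableOn hne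
    rw [setIntegral_condExp (ℱ.le n) hint hE, setIntegral_indicator hW] at h1
    simp only [Pi.one_apply, setIntegral_const, smul_eq_mul, mul_one] at h1
    have h2 := h n hn _ hE
    rw [Set.inter_comm] at h2
    linarith
  have hlim := hint.tendsto_ae_condExp (ℱ := ℱ)
    (by rw [hℱ]; exact (stronglyMeasurable_one.indicator hW))
  have hall : ∀ᵐ ω ∂μ, ∀ n, n₀ ≤ n → μ[W.indicator (1 : Ω → ℝ) | ℱ n] ω ≤ a :=
    ae_all_iff.2 fun n => by
      by_cases hn : n₀ ≤ n
      · filter_upwards [hle n hn] with ω hω _ using hω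
      · exact ae_of_all _ fun ω h => absurd h hn
  rw [measure_eq_zero_iff_ae_notMem]
  filter_upwards [hlim, hall] with ω h1 h2 hω
  have h3 := le_of_tendsto h1 (eventually_atTop.2 ⟨n₀, h2⟩)
  rw [Set.indicator_of_mem hω, Pi.one_apply] at h3
  linarith

/-! ### Averages over an increasing sequence of finite groups -/

namespace GroupAverage

variable {Ω G : Type*} [AddCommGroup G] {T : G → Ω → Ω} {H : ℕ → AddSubgroup G}
  [∀ k, Fintype (H k)]

/-- The average of `f` over the orbit under the finite group `H k`. -/
def avg (T : G → Ω → Ω) (H : ℕ → AddSubgroup G) [∀ k, Fintype (H k)] (k : ℕ) (f : Ω → ℝ)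
    (ω : Ω) : ℝ :=
  (Fintype.card (H k) : ℝ)⁻¹ * ∑ a : H k, f (T a ω)

theorem card_pos (k : ℕ) : (0 : ℝ) < Fintype.card (H k) := by
  exact_mod_cast Fintype.card_pos

theorem avg_mono {k : ℕ} {f g : Ω → ℝ} (h : ∀ ω, f ω ≤ g ω) (ω : Ω) :
    avg T H k f ω ≤ avg T H k g ω :=
  mul_le_mul_of_nonneg_left (Finset.sum_le_sum fun _ _ => h _) (inv_nonneg.2 (card_pos k).le)

theorem avg_sub (k : ℕ) (f g : Ω → ℝ) (ω : Ω) :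
    avg T H k (fun ω => f ω - g ω) ω = avg T H k f ω - avg T H k g ω := by
  simp only [avg, Finset.sum_sub_distrib, mul_sub]

theorem abs_avg_le (k : ℕ) (f : Ω → ℝ) (ω : Ω) :
    |avg T H k f ω| ≤ avg T H k (fun ω => |f ω|) ω := by
  rw [avg, abs_mul, abs_of_nonneg (inv_nonneg.2 (card_pos k).le)]
  exact mul_le_mul_of_nonneg_left (Finset.abs_sum_le_sum_abs _ _) (inv_nonneg.2 (card_pos k).le)

theorem avg_eq_self {k : ℕ} {f : Ω → ℝ} (h : ∀ a ∈ H k, ∀ ω, f (T a ω) = f ω) (ω : Ω) :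
    avg T H k f ω = f ω := by
  simp only [avg, h _ (SetLike.coe_mem _), Finset.sum_const, Finset.card_univ, nsmul_eq_mul]
  exact inv_mul_cancel_left₀ (card_pos k).ne' _

theorem avg_const (k : ℕ) (b : ℝ) (ω : Ω) : avg T H k (fun _ => b) ω = b :=
  avg_eq_self (T := T) (f := fun _ => b) (fun _ _ _ => rfl) ω

theorem abs_avg_le_of_abs_le {f : Ω → ℝ} {b : ℝ} (h : ∀ ω, |f ω| ≤ b) (k : ℕ) (ω : Ω) :
    |avg T H k f ω| ≤ b :=
  (abs_avg_le k f ω).trans ((avg_mono h ω).trans (avg_const k b ω).le)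

section

variable (hadd : ∀ a b ω, T (a + b) ω = T a (T b ω))
include hadd

theorem avg_apply_translate {k : ℕ} (f : Ω → ℝ) {b : G} (hb : b ∈ H k) (ω : Ω) :
    avg T H k f (T b ω) = avg T H k f ω := by
  rw [avg, avg]
  congr 1
  refine Fintype.sum_equiv (Equiv.addRight ⟨b, hb⟩) _ _ fun a => ?_
  rw [← hadd]
  rfl

theorem avg_apply_translate_of_le (hH : Monotone H) {j k : ℕ} (hjk : j ≤ k) (f : Ω → ℝ) {b : G}
    (hb : b ∈ H j) (ω : Ω) : avg T H k f (T b ω) = avg T H k f ω :=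
  avg_apply_translate hadd f (hH hjk hb) ω

theorem avg_avg_of_le (hH : Monotone H) {j k : ℕ} (hjk : j ≤ k) (f : Ω → ℝ) (ω : Ω) :
    avg T H k (avg T H j f) ω = avg T H k f ω := by
  have h1 : ∀ b : H j, ∑ a : H k, f (T b (T a ω)) = ∑ a : H k, f (T a ω) := fun b => by
    refine Fintype.sum_equiv (Equiv.addLeft ⟨b, hH hjk b.2⟩) _ _ fun a => ?_
    rw [← hadd]
    rfl
  rw [avg, avg]
  congr 1
  simp only [avg]
  rw [← Finset.mul_sum, Finset.sum_comm, Finset.sum_congr rfl fun b _ => h1 b, Finset.sum_const,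
    Finset.card_univ, nsmul_eq_mul]
  exact inv_mul_cancel_left₀ (card_pos j).ne' _

theorem avg_avg_of_ge (hH : Monotone H) {j k : ℕ} (hjk : j ≤ k) (f : Ω → ℝ) (ω : Ω) :
    avg T H j (avg T H k f) ω = avg T H k f ω :=
  avg_eq_self (fun _ hb ω => avg_apply_translate_of_le hadd hH hjk f hb ω) ω

end

variable [MeasurableSpace Ω] {μ : Measure Ω} [IsProbabilityMeasure μ]

theorem integrable_of_abs_le {f : Ω → ℝ} {b : ℝ} (hf : Measurable f) (h : ∀ ω, |f ω| ≤ b) :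
    Integrable f μ :=
  Integrable.of_bound hf.aestronglyMeasurable b (ae_of_all _ h)

section

variable (hT : ∀ a, MeasurePreserving (T a) μ μ)
include hT

omit [IsProbabilityMeasure μ] in
theorem measurable_avg {f : Ω → ℝ} (hf : Measurable f) (k : ℕ) : Measurable (avg T H k f) := by
  unfold avg
  exact (Finset.measurable_fun_sum Finset.univ
    fun (a : H k) _ => hf.comp (hT a).measurable).const_mul _

theorem integral_avg_mul {f g : Ω → ℝ} {b d : ℝ} (hf : Measurable f) (hfb : ∀ ω, |f ω| ≤ b)
    (hg : Measurable g) (hgd : ∀ ω, |g ω| ≤ d) {k : ℕ} (hinv : ∀ a ∈ H k, ∀ ω, g (T a ω) = g ω) :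
    ∫ ω, avg T H k f ω * g ω ∂μ = ∫ ω, f ω * g ω ∂μ := by
  have h1 : ∀ a : H k, ∫ ω, f (T a ω) * g ω ∂μ = ∫ ω, f ω * g ω ∂μ := fun a => by
    have : ∀ ω, f (T a ω) * g ω = (fun ω => f ω * g ω) (T a ω) := fun ω => by
      simp only [hinv a a.2 ω]
    simp_rw [this]
    rw [← integral_map (f := fun ω => f ω * g ω) (hT a).measurable.aemeasurable
      (hf.mul hg).aestronglyMeasurable, (hT a).map_eq]
  have h2 : ∀ a : H k, Integrable (fun ω => f (T a ω) * g ω) μ := fun a =>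
    integrable_of_abs_le (b := b * d) ((hf.comp (hT a).measurable).mul hg) fun ω => by
      rw [abs_mul]
      exact mul_le_mul (hfb _) (hgd _) (abs_nonneg _) ((abs_nonneg _).trans (hfb ω))
  simp_rw [avg, mul_assoc, Finset.sum_mul]
  rw [integral_const_mul, integral_finsetSum _ fun a _ => h2 a,
    Finset.sum_congr rfl fun a _ => h1 a, Finset.sum_const, Finset.card_univ, nsmul_eq_mul]
  exact inv_mul_cancel_left₀ (card_pos k).ne' _

variable (hadd : ∀ a b ω, T (a + b) ω = T a (T b ω)) (hH : Monotone H)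
include hadd hH

/-- The averages are orthogonal projections onto decreasing subspaces of `L²`. -/
theorem integral_sq_avg_sub_avg {f : Ω → ℝ} {b : ℝ} (hf : Measurable f) (hfb : ∀ ω, |f ω| ≤ b)
    {j k : ℕ} (hjk : j ≤ k) :
    ∫ ω, (avg T H j f ω - avg T H k f ω) ^ 2 ∂μ =
      ∫ ω, avg T H j f ω ^ 2 ∂μ - ∫ ω, avg T H k f ω ^ 2 ∂μ := by
  have hmj := measurable_avg (H := H) hT hf j
  have hmk := measurable_avg (H := H) hT hf k
  have hbj := abs_avg_le_of_abs_le (T := T) (H := H) hfb j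
  have hbk := abs_avg_le_of_abs_le (T := T) (H := H) hfb k
  have hcross : ∫ ω, avg T H j f ω * avg T H k f ω ∂μ = ∫ ω, avg T H k f ω ^ 2 ∂μ := by
    rw [← integral_avg_mul hT hmj hbj hmk hbk (k := k) fun a ha ω =>
      avg_apply_translate hadd f ha ω]
    simp_rw [avg_avg_of_le hadd hH hjk, sq]
  have hi : ∀ {u v : Ω → ℝ}, Measurable u → (∀ ω, |u ω| ≤ b) → Measurable v →
      (∀ ω, |v ω| ≤ b) → Integrable (fun ω => u ω * v ω) μ := fun hu hub hv hvb =>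
    integrable_of_abs_le (b := b * b) (hu.mul hv) fun ω => by
      rw [abs_mul]
      exact mul_le_mul (hub _) (hvb _) (abs_nonneg _) ((abs_nonneg _).trans (hub ω))
  have hexp : ∀ ω, (avg T H j f ω - avg T H k f ω) ^ 2 = avg T H j f ω ^ 2 -
      2 * (avg T H j f ω * avg T H k f ω) + avg T H k f ω ^ 2 := fun ω => by ring
  have hjj : Integrable (fun ω => avg T H j f ω ^ 2) μ := by
    simpa only [sq] using hi hmj hbj hmj hbj
  have hkk : Integrable (fun ω => avg T H k f ω ^ 2) μ := by
    simpa only [sq] using hi hmk hbk hmk hbk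
  have hjk' := (hi hmj hbj hmk hbk).const_mul 2
  simp_rw [hexp]
  rw [integral_add (f := fun ω => avg T H j f ω ^ 2 - 2 * (avg T H j f ω * avg T H k f ω))
    (hjj.sub hjk') hkk, integral_sub hjj hjk', integral_const_mul, hcross]
  ring

/-- The maximal inequality: decompose according to the largest `j ≤ n` for which the average
exceeds `lam`; this event is invariant under `H j`. -/
theorem maximal_inequality {g : Ω → ℝ} {b : ℝ} (hg : Measurable g) (hgb : ∀ ω, |g ω| ≤ b)
    (hg0 : ∀ ω, 0 ≤ g ω) (lam : ℝ) (n : ℕ) :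
    lam * μ.real {ω | ∃ j ≤ n, lam < avg T H j g ω} ≤ ∫ ω, g ω ∂μ := by
  rcases lt_or_ge lam 0 with hl | hl
  · exact (mul_nonpos_of_nonpos_of_nonneg hl.le measureReal_nonneg).trans (integral_nonneg hg0)
  have hgi : Integrable g μ := integrable_of_abs_le hg hgb
  have hm : ∀ j, Measurable (avg T H j g) := measurable_avg hT hg
  let E : ℕ → Set Ω := fun j =>
    {ω | lam < avg T H j g ω} ∩ ⋂ i ∈ Finset.Ioc j n, {ω | avg T H i g ω ≤ lam}
  have hE : ∀ j, MeasurableSet (E j) := fun j =>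
    (measurableSet_lt measurable_const (hm j)).inter
      (Finset.measurableSet_biInter _ fun i _ => measurableSet_le (hm i) measurable_const)
  have hinv : ∀ j, ∀ a ∈ H j, ∀ ω, T a ω ∈ E j ↔ ω ∈ E j := by
    intro j a ha ω
    simp only [E, Set.mem_inter_iff, Set.mem_ofPred_eq, Set.mem_iInter, Finset.mem_Ioc]
    rw [avg_apply_translate hadd g ha]
    refine and_congr_right fun _ => forall₂_congr fun i hi => ?_
    rw [avg_apply_translate_of_le hadd hH hi.1.le g ha]
  have hdisj : Set.Pairwise (↑(Finset.range (n + 1))) (Function.onFun Disjoint E) := by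
    have key : ∀ i j, i < j → j ≤ n → Disjoint (E i) (E j) := by
      intro i j hij hj
      rw [Set.disjoint_left]
      intro ω hi hj'
      have h1 : avg T H j g ω ≤ lam :=
        Set.mem_iInter₂.1 hi.2 j (Finset.mem_Ioc.2 ⟨hij, hj⟩)
      exact absurd hj'.1 (not_lt.2 h1)
    intro i hi j hj hij
    simp only [Finset.coe_range, Set.mem_Iio] at hi hj
    rcases lt_or_gt_of_ne hij with h | h
    · exact key i j h (by omega)
    · exact (key j i h (by omega)).symm
  have hcov : {ω | ∃ j ≤ n, lam < avg T H j g ω} ⊆ ⋃ j ∈ Finset.range (n + 1), E j := by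
    classical
    rintro ω ⟨j, hj, hω⟩
    set P : ℕ → Prop := fun i => lam < avg T H i g ω with hP
    have hs : P (Nat.findGreatest P n) := Nat.findGreatest_spec (P := P) hj hω
    refine Set.mem_iUnion₂.2 ⟨Nat.findGreatest P n,
      Finset.mem_range.2 (Nat.lt_succ_of_le (Nat.findGreatest_le n)), hs, ?_⟩
    refine Set.mem_iInter₂.2 fun i hi => ?_
    rw [Finset.mem_Ioc] at hi
    exact not_lt.1 (Nat.findGreatest_is_greatest (P := P) hi.1 hi.2)
  have hone : ∀ j, lam * μ.real (E j) ≤ ∫ ω in E j, g ω ∂μ := by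
    intro j
    have h1 : ∫ ω in E j, g ω ∂μ = ∫ ω in E j, avg T H j g ω ∂μ := by
      rw [← integral_indicator (hE j), ← integral_indicator (hE j)]
      have h2 := integral_avg_mul (H := H) hT hg hgb (g := (E j).indicator 1) (d := 1) (k := j)
        (measurable_one.indicator (hE j)) (fun ω => by
          by_cases hω : ω ∈ E j <;> simp [hω]) (fun a ha ω => by
          by_cases hω : ω ∈ E j
          · simp [hω, (hinv j a ha ω).2 hω]
          · simp [hω, mt (hinv j a ha ω).1 hω])
      have h3 : ∀ u : Ω → ℝ, (E j).indicator u = fun ω => u ω * (E j).indicator 1 ω := fun u => by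
        funext ω
        by_cases hω : ω ∈ E j <;> simp [hω]
      rw [h3 g, h3 (avg T H j g), h2]
    rw [h1]
    have h4 : ∫ _ in E j, lam ∂μ ≤ ∫ ω in E j, avg T H j g ω ∂μ :=
      setIntegral_mono_on (integrable_const lam).integrableOn
        (integrable_of_abs_le (hm j) (abs_avg_le_of_abs_le hgb j)).integrableOn (hE j)
        fun ω hω => (le_of_lt hω.1)
    rw [setIntegral_const, smul_eq_mul, mul_comm] at h4
    exact h4
  calc lam * μ.real {ω | ∃ j ≤ n, lam < avg T H j g ω}
      ≤ lam * ∑ j ∈ Finset.range (n + 1), μ.real (E j) :=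
        mul_le_mul_of_nonneg_left ((measureReal_mono hcov (measure_ne_top _ _)).trans
          (measureReal_biUnion_finset_le _ _)) hl
    _ ≤ ∑ j ∈ Finset.range (n + 1), ∫ ω in E j, g ω ∂μ := by
        rw [Finset.mul_sum]
        exact Finset.sum_le_sum fun j _ => hone j
    _ = ∫ ω in ⋃ j ∈ Finset.range (n + 1), E j, g ω ∂μ :=
        (integral_biUnion_finset _ (fun j _ => hE j) hdisj fun j _ => hgi.integrableOn).symm
    _ ≤ ∫ ω, g ω ∂μ := setIntegral_le_integral hgi (ae_of_all _ hg0)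

/-- The maximal inequality for the increments of the averages. -/
theorem measure_exists_lt_abs_avg_sub_le {f : Ω → ℝ} {b : ℝ} (hf : Measurable f)
    (hfb : ∀ ω, |f ω| ≤ b) {lam : ℝ} (hlam : 0 < lam) {k n : ℕ} (hkn : k ≤ n) :
    μ.real {ω | ∃ j, k ≤ j ∧ j ≤ n ∧ 2 * lam < |avg T H j f ω - avg T H k f ω|} ≤
      √(∫ ω, avg T H k f ω ^ 2 ∂μ - ∫ ω, avg T H n f ω ^ 2 ∂μ) / lam := by
  have hmk := measurable_avg (H := H) hT hf k
  have hmn := measurable_avg (H := H) hT hf n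
  set g : Ω → ℝ := fun ω => |avg T H k f ω - avg T H n f ω| with hgdef
  have hgm : Measurable g := (hmk.sub hmn).abs
  have hgb : ∀ ω, |g ω| ≤ b + b := fun ω => by
    rw [hgdef, abs_abs]
    exact (abs_sub _ _).trans (add_le_add (abs_avg_le_of_abs_le hfb k ω)
      (abs_avg_le_of_abs_le hfb n ω))
  have hmax := maximal_inequality hT hadd hH hgm hgb (fun ω => abs_nonneg _) lam n
  have hincr : ∀ j, k ≤ j → j ≤ n → ∀ ω, |avg T H j f ω - avg T H n f ω| ≤ avg T H j g ω := by
    intro j hkj hjn ω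
    rw [← avg_avg_of_le hadd hH hkj f ω, ← avg_avg_of_ge hadd hH hjn f ω, ← avg_sub]
    exact abs_avg_le j _ ω
  have hsub : {ω | ∃ j, k ≤ j ∧ j ≤ n ∧ 2 * lam < |avg T H j f ω - avg T H k f ω|} ⊆
      {ω | ∃ j ≤ n, lam < avg T H j g ω} := by
    rintro ω ⟨j, hkj, hjn, hω⟩
    by_contra hne
    have hno : ∀ j, j ≤ n → avg T H j g ω ≤ lam := fun j hj =>
      not_lt.1 fun h => hne ⟨j, hj, h⟩
    have h1 := (hincr j hkj hjn ω).trans (hno j hjn)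
    have h2 := (hincr k le_rfl hkn ω).trans (hno k hkn)
    have h3 := abs_sub_le (avg T H j f ω) (avg T H n f ω) (avg T H k f ω)
    rw [abs_sub_comm (avg T H n f ω)] at h3
    linarith
  have hint : ∫ ω, g ω ∂μ ≤ √(∫ ω, avg T H k f ω ^ 2 ∂μ - ∫ ω, avg T H n f ω ^ 2 ∂μ) := by
    rw [← integral_sq_avg_sub_avg hT hadd hH hf hfb hkn]
    refine Real.le_sqrt_of_sq_le ?_
    have hL : MemLp g 2 μ := MemLp.of_bound hgm.aestronglyMeasurable (b + b) (ae_of_all _ hgb)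
    have hvar := variance_nonneg g μ
    rw [variance_eq_sub hL] at hvar
    have : ∫ ω, (g ^ 2) ω ∂μ = ∫ ω, (avg T H k f ω - avg T H n f ω) ^ 2 ∂μ :=
      integral_congr_ae (ae_of_all _ fun ω => by simp [hgdef, sq_abs])
    linarith
  rw [le_div_iff₀ hlam, mul_comm]
  exact (mul_le_mul_of_nonneg_left (measureReal_mono hsub (measure_ne_top _ _)) hlam.le).trans
    (hmax.trans hint)

/-- The pointwise ergodic theorem for an increasing sequence of finite groups. -/
theorem ae_tendsto_avg {f : Ω → ℝ} {b : ℝ} (hf : Measurable f) (hfb : ∀ ω, |f ω| ≤ b) :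
    ∀ᵐ ω ∂μ, ∃ d, Tendsto (fun k => avg T H k f ω) atTop (𝓝 d) := by
  set s : ℕ → ℝ := fun k => ∫ ω, avg T H k f ω ^ 2 ∂μ with hs
  have hanti : Antitone s := fun j k hjk => by
    have h1 := integral_sq_avg_sub_avg hT hadd hH hf hfb hjk
    have h2 : 0 ≤ ∫ ω, (avg T H j f ω - avg T H k f ω) ^ 2 ∂μ :=
      integral_nonneg fun ω => sq_nonneg _
    simp only [hs]
    linarith
  have hbdd : BddBelow (Set.range s) :=
    ⟨0, by rintro _ ⟨k, rfl⟩; exact integral_nonneg fun ω => sq_nonneg _⟩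
  have hlim := tendsto_atTop_ciInf hanti hbdd
  have hm := fun k => measurable_avg (H := H) hT hf k
  have hnull : ∀ m : ℕ, ∀ᵐ ω ∂μ, ∃ k, ∀ j, k ≤ j →
      |avg T H j f ω - avg T H k f ω| ≤ 2 * ((m : ℝ) + 1)⁻¹ := by
    intro m
    set lam : ℝ := ((m : ℝ) + 1)⁻¹ with hlamdef
    have hlam : 0 < lam := by positivity
    have hB : ∀ k, μ {ω | ∃ j, k ≤ j ∧ 2 * lam < |avg T H j f ω - avg T H k f ω|} ≤
        ENNReal.ofReal (√(s k - ⨅ i, s i) / lam) := by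
      intro k
      have hU : {ω | ∃ j, k ≤ j ∧ 2 * lam < |avg T H j f ω - avg T H k f ω|} =
          ⋃ n, {ω | ∃ j, k ≤ j ∧ j ≤ n ∧ 2 * lam < |avg T H j f ω - avg T H k f ω|} := by
        ext ω
        simp only [Set.mem_iUnion, Set.mem_ofPred_eq]
        exact ⟨fun ⟨j, h1, h2⟩ => ⟨j, j, h1, le_rfl, h2⟩, fun ⟨_, j, h1, _, h2⟩ => ⟨j, h1, h2⟩⟩
      rw [hU]
      have hmono : Monotone fun n =>
          {ω | ∃ j, k ≤ j ∧ j ≤ n ∧ 2 * lam < |avg T H j f ω - avg T H k f ω|} :=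
        fun n n' hn ω ⟨j, h1, h2, h3⟩ => ⟨j, h1, h2.trans hn, h3⟩
      rw [hmono.measure_iUnion]
      refine iSup_le fun n => ?_
      refine (measure_mono (hmono (le_max_left n k))).trans ?_
      rw [← ofReal_measureReal (measure_ne_top _ _)]
      refine ENNReal.ofReal_le_ofReal
        ((measure_exists_lt_abs_avg_sub_le hT hadd hH hf hfb hlam (le_max_right n k)).trans ?_)
      exact div_le_div_of_nonneg_right (Real.sqrt_le_sqrt
        (sub_le_sub_left (ciInf_le hbdd _) _)) hlam.le
    have hzero : Tendsto (fun k => ENNReal.ofReal (√(s k - ⨅ i, s i) / lam)) atTop (𝓝 0) := by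
      have h1 : Tendsto (fun k => √(s k - ⨅ i, s i) / lam) atTop (𝓝 (√0 / lam)) := by
        refine Tendsto.div_const ((Real.continuous_sqrt.tendsto _).comp ?_) _
        simpa using hlim.sub_const (⨅ i, s i)
      simpa using ENNReal.tendsto_ofReal h1
    rw [ae_iff]
    refine le_antisymm (ge_of_tendsto' hzero fun k => (measure_mono fun ω hω => ?_).trans (hB k))
      zero_le
    simp only [Set.mem_ofPred_eq, not_exists, not_forall, not_le, exists_prop] at hω ⊢
    exact hω k
  filter_upwards [ae_all_iff.2 hnull] with ω hω
  refine cauchySeq_tendsto_of_complete (Metric.cauchySeq_iff'.2 fun ε hε => ?_)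
  obtain ⟨m, hm⟩ := exists_nat_one_div_lt (show (0 : ℝ) < ε / 2 by positivity)
  obtain ⟨k, hk⟩ := hω m
  refine ⟨k, fun j hj => ?_⟩
  rw [Real.dist_eq]
  refine (hk j hj).trans_lt ?_
  rw [one_div] at hm
  linarith

end

end GroupAverage

namespace HierarchicalPercolation

variable {N : ℕ}

/-! ### The geometry of the hierarchical group -/

theorem hdist_le_iff {x y : HierGroup N} {k : ℕ} : hdist x y ≤ k ↔ ∀ i, k ≤ i → x i = y i := by
  simp only [hdist, Finset.sup_le_iff, Finsupp.mem_neLocus]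
  constructor
  · intro h i hi
    by_contra hne
    have := h i hne
    omega
  · intro h i hne
    by_contra hi
    exact hne (h i (by omega))

@[simp]
theorem hdist_self (x : HierGroup N) : hdist x x = 0 := by simp [hdist]

theorem hdist_le_trans {x y z : HierGroup N} {k : ℕ} (hxy : hdist x y ≤ k) (hyz : hdist y z ≤ k) :
    hdist x z ≤ k := by
  rw [hdist_le_iff] at *
  exact fun i hi => (hxy i hi).trans (hyz i hi)

theorem hdist_le_symm {x y : HierGroup N} {k : ℕ} (h : hdist x y ≤ k) : hdist y x ≤ k :=
  hdist_comm x y ▸ h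

theorem hdist_le_zero {x y : HierGroup N} : hdist x y ≤ 0 ↔ x = y := by
  rw [hdist_le_iff]
  exact ⟨fun h => Finsupp.ext fun i => h i (Nat.zero_le i), fun h i _ => h ▸ rfl⟩

theorem hdist_add_left (a x y : HierGroup N) : hdist (a + x) (a + y) = hdist x y := by
  refine eq_of_forall_ge_iff fun k => ?_
  simp [hdist_le_iff]

theorem lt_hdist_of_le {u u' w w' : HierGroup N} {k : ℕ} (huw : k < hdist u w)
    (hu : hdist u u' ≤ k) (hw : hdist w w' ≤ k) : k < hdist u' w' := by
  by_contra h
  exact absurd (hdist_le_trans (hdist_le_trans hu (not_lt.1 h)) (hdist_le_symm hw)) (by omega)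

/-- The centre of the `k`-ball of `x`, whose first `k` coordinates vanish. -/
def centre (k : ℕ) (x : HierGroup N) : HierGroup N := x.filter (k ≤ ·)

theorem centre_apply (k : ℕ) (x : HierGroup N) (i : ℕ) :
    centre k x i = if k ≤ i then x i else 0 := Finsupp.filter_apply _ _ _

theorem hdist_centre_le (k : ℕ) (x : HierGroup N) : hdist (centre k x) x ≤ k :=
  hdist_le_iff.2 fun i hi => by rw [centre_apply, if_pos hi]

theorem centre_eq_iff {k : ℕ} {x y : HierGroup N} : centre k x = centre k y ↔ hdist x y ≤ k := by
  constructor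
  · intro h
    exact hdist_le_trans (hdist_le_symm (hdist_centre_le k x)) (h ▸ hdist_centre_le k y)
  · intro h
    ext i
    simp only [centre_apply]
    split_ifs with hi
    exacts [hdist_le_iff.1 h i hi, rfl]

section Balls

variable [NeZero N]

/-- The ball of diameter `k` around `x`, as a finite set. -/
def ballF (k : ℕ) (x : HierGroup N) : Finset (HierGroup N) :=
  ((Finset.range k).finsupp fun _ => (Finset.univ : Finset (ZMod N))).map (addLeftEmbedding x)

@[simp]
theorem mem_ballF {k : ℕ} {x y : HierGroup N} : y ∈ ballF k x ↔ hdist x y ≤ k := by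
  simp only [ballF, Finset.mem_map, Finset.mem_finsupp_iff, addLeftEmbedding_apply, hdist_le_iff]
  constructor
  · rintro ⟨f, ⟨hf, -⟩, rfl⟩ i hi
    have : f i = 0 := by
      by_contra hne
      have := Finset.mem_range.1 (hf (Finsupp.mem_support_iff.2 hne))
      omega
    simp [this]
  · intro h
    refine ⟨y - x, ⟨fun i hi => ?_, by simp⟩, by simp⟩
    rw [Finset.mem_range]
    by_contra hik
    exact (Finsupp.mem_support_iff.1 hi) (by simp [h i (by omega)])

@[simp]
theorem card_ballF (k : ℕ) (x : HierGroup N) : (ballF k x).card = N ^ k := by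
  simp [ballF, Finset.card_finsupp, ZMod.card]

theorem ballF_congr {k : ℕ} {x y : HierGroup N} (h : hdist x y ≤ k) : ballF k x = ballF k y := by
  ext z
  simp only [mem_ballF]
  exact ⟨hdist_le_trans (hdist_le_symm h), hdist_le_trans h⟩

theorem ballF_subset {j k : ℕ} {x y : HierGroup N} (hjk : j ≤ k) (h : hdist x y ≤ k) :
    ballF j y ⊆ ballF k x := fun z hz => by
  rw [mem_ballF] at *
  exact hdist_le_trans h (hz.trans hjk)

theorem disjoint_ballF {k : ℕ} {x y : HierGroup N} (h : k < hdist x y) :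
    Disjoint (ballF k x) (ballF k y) := by
  rw [Finset.disjoint_left]
  intro z hx hy
  rw [mem_ballF] at *
  exact absurd (hdist_le_trans hx (hdist_le_symm hy)) (by omega)

open Classical in
/-- The centres of the `k`-balls that make up the `(k + 1)`-ball of `x`. -/
def centres (k : ℕ) (x : HierGroup N) : Finset (HierGroup N) :=
  (ballF (k + 1) x).image (centre k)

theorem centre_mem_centres {k : ℕ} {x y : HierGroup N} (h : hdist x y ≤ k + 1) :
    centre k y ∈ centres k x :=
  Finset.mem_image.2 ⟨y, mem_ballF.2 h, rfl⟩

theorem hdist_le_of_mem_centres {k : ℕ} {x r : HierGroup N} (h : r ∈ centres k x) :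
    hdist x r ≤ k + 1 := by
  obtain ⟨y, hy, rfl⟩ := Finset.mem_image.1 h
  exact hdist_le_trans (mem_ballF.1 hy) ((hdist_le_symm (hdist_centre_le k y)).trans k.le_succ)

theorem centre_eq_self_of_mem_centres {k : ℕ} {x r : HierGroup N} (h : r ∈ centres k x) :
    centre k r = r := by
  obtain ⟨y, hy, rfl⟩ := Finset.mem_image.1 h
  exact centre_eq_iff.2 (hdist_centre_le k y)

theorem lt_hdist_of_mem_centres {k : ℕ} {x r s : HierGroup N} (hr : r ∈ centres k x)
    (hs : s ∈ centres k x) (h : r ≠ s) : k < hdist r s := by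
  by_contra hle
  have := centre_eq_iff.2 (not_lt.1 hle)
  rw [centre_eq_self_of_mem_centres hr, centre_eq_self_of_mem_centres hs] at this
  exact h this

theorem sum_ballF_succ {M : Type*} [AddCommMonoid M] (k : ℕ) (x : HierGroup N)
    (f : HierGroup N → M) :
    ∑ y ∈ ballF (k + 1) x, f y = ∑ r ∈ centres k x, ∑ y ∈ ballF k r, f y := by
  classical
  rw [← Finset.sum_fiberwise_of_maps_to (s := ballF (k + 1) x) (t := centres k x) (g := centre k)
    fun y hy => centre_mem_centres (mem_ballF.1 hy)]
  refine Finset.sum_congr rfl fun r hr => Finset.sum_congr ?_ fun _ _ => rfl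
  ext y
  rw [Finset.mem_filter, mem_ballF, mem_ballF, ← centre_eq_iff (k := k),
    centre_eq_self_of_mem_centres hr]
  refine ⟨fun h => h.2.symm, fun h => ⟨?_, h.symm⟩⟩
  have h1 := hdist_centre_le k y
  rw [← h] at h1
  exact hdist_le_trans (hdist_le_of_mem_centres hr) (h1.trans k.le_succ)

theorem card_centres (k : ℕ) (x : HierGroup N) : (centres k x).card = N := by
  have h := sum_ballF_succ k x fun _ => 1
  simp only [Finset.sum_const, card_ballF, smul_eq_mul, mul_one, pow_succ'] at h
  exact (Nat.eq_of_mul_eq_mul_right (pow_pos (NeZero.pos N) k) h).symm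

end Balls

/-! ### Independence of the edges -/

instance (c : ℕ → ℝ) : IsProbabilityMeasure (percMeasure N c) := by
  unfold percMeasure; infer_instance

/-- The σ-algebra generated by the states of the pairs in `I`. -/
@[reducible]
def cyl (I : Set (Sym2 (HierGroup N))) : MeasurableSpace (Config N) :=
  ⨆ e ∈ I, MeasurableSpace.comap (fun ω : Config N => ω e) inferInstance

theorem cyl_le (I : Set (Sym2 (HierGroup N))) : cyl I ≤ MeasurableSpace.pi :=
  iSup₂_le fun e _ => (measurable_pi_apply e).comap_le

theorem cyl_mono {I J : Set (Sym2 (HierGroup N))} (h : I ⊆ J) : cyl I ≤ cyl J :=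
  biSup_mono h

theorem measurable_cyl_apply {I : Set (Sym2 (HierGroup N))} {e : Sym2 (HierGroup N)}
    (he : e ∈ I) : Measurable[cyl I] fun ω : Config N => ω e :=
  Measurable.mono (comap_measurable _)
    (le_iSup₂ (f := fun e _ => MeasurableSpace.comap (fun ω : Config N => ω e) inferInstance) e he)
    le_rfl

theorem indep_cyl (c : ℕ → ℝ) {I J : Set (Sym2 (HierGroup N))} (h : Disjoint I J) :
    Indep (cyl I) (cyl J) (percMeasure N c) := by
  have h0 : iIndepFun (fun (e : Sym2 (HierGroup N)) (ω : Config N) => ω e) (percMeasure N c) :=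
    iIndepFun_infinitePi (X := fun _ b => b) fun _ => measurable_id
  exact indep_iSup_of_disjoint (fun e => (measurable_pi_apply e).comap_le) h0.iIndep h

theorem measurable_cyl_of_dependsOn {β : Type*} [Nonempty β] [MeasurableSpace β]
    {f : Config N → β} {I : Finset (Sym2 (HierGroup N))}
    (h : DependsOn f (I : Set (Sym2 (HierGroup N)))) : Measurable[cyl I] f := by
  obtain ⟨g, rfl⟩ := dependsOn_iff_exists_comp.1 h
  have hg : Measurable g := Measurable.of_discrete
  have hr : Measurable[cyl (I : Set (Sym2 (HierGroup N)))]
      ((I : Set (Sym2 (HierGroup N))).domRestrict (π := fun _ => Bool)) :=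
    (@measurable_pi_iff _ _ _ (_) _ _).2 fun e => measurable_cyl_apply e.2
  exact fun s hs => hr (hg hs)

theorem measurableSet_cyl_of_dependsOn {p : Config N → Prop} {I : Finset (Sym2 (HierGroup N))}
    (h : DependsOn p (I : Set (Sym2 (HierGroup N)))) : MeasurableSet[cyl I] {ω | p ω} := by
  have := measurable_cyl_of_dependsOn h (measurableSet_singleton True)
  simpa [Set.preimage, Set.mem_singleton_iff] using this

theorem measurableSet_of_dependsOn {p : Config N → Prop} {I : Finset (Sym2 (HierGroup N))}
    (h : DependsOn p (I : Set (Sym2 (HierGroup N)))) : MeasurableSet {ω | p ω} :=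
  cyl_le _ _ (measurableSet_cyl_of_dependsOn h)

theorem percMeasure_closed (c : ℕ → ℝ) (F : Finset (Sym2 (HierGroup N))) :
    percMeasure N c {ω | ∀ e ∈ F, ω e = false} =
      ∏ e ∈ F, ENNReal.ofReal (1 - connProb N c (edgeLength e)) := by
  have : {ω : Config N | ∀ e ∈ F, ω e = false} = (F : Set _).pi fun _ => {false} := by
    ext ω; simp [Set.mem_pi]
  rw [this, percMeasure, Measure.infinitePi_pi _ fun _ _ => MeasurableSet.singleton _]
  refine Finset.prod_congr rfl fun e _ => ?_
  rw [bernoulliMeasure_apply_of_notMem_of_mem _ (MeasurableSet.singleton _) (by simp) (by simp)]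
  rw [ENNReal.ofReal]
  congr 1
  ext
  simp only [unitInterval.toNNReal, unitInterval.symm, Real.coe_toNNReal']
  exact (max_eq_left (sub_nonneg.2 (connProb N c (edgeLength e)).2.2)).symm

theorem one_sub_connProb_le (c : ℕ → ℝ) (k : ℕ) :
    1 - (connProb N c k : ℝ) ≤ Real.exp (-(c k / (N : ℝ) ^ (2 * k))) := by
  rw [connProb, Set.coe_projIcc]
  set q := c k / (N : ℝ) ^ (2 * k)
  have := Real.add_one_le_exp (-q)
  have := (Real.exp_pos (-q)).le
  rcases le_total 1 q with h | h
  · simpa [h]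
  · rw [min_eq_right h]
    have := le_max_right 0 q
    linarith

section

variable [NeZero N]

/-! ### The renormalisation scheme -/

open Classical in
/-- The number of points of `A` in the `k`-ball of `x`. -/
def count (A : Set (HierGroup N)) (k : ℕ) (x : HierGroup N) : ℕ :=
  ((ballF k x).filter (· ∈ A)).card

/-- Any two `k`-balls in the `(k + 1)`-ball of `x` that meet `A` are joined by an open edge
between points of `A`. -/
def Linked (k : ℕ) (A : Set (HierGroup N)) (ω : Config N) (x : HierGroup N) : Prop :=
  ∀ u ∈ A, ∀ w ∈ A, hdist x u ≤ k + 1 → hdist x w ≤ k + 1 → k < hdist u w →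
    ∃ u' ∈ A, ∃ w' ∈ A, hdist u u' ≤ k ∧ hdist w w' ≤ k ∧ ω s(u', w') = true

/-- The vertices that are alive at level `k`. All points are alive at level `0`. The points alive
at level `k` in a ball of diameter `k + 1` stay alive if its `k`-balls are linked through alive
points and at least one eighth of the points of the ball is alive; otherwise they all die. -/
def alive : ℕ → Config N → Set (HierGroup N)
  | 0, _ => Set.univ
  | k + 1, ω => {y | y ∈ alive k ω ∧ Linked k (alive k ω) ω y ∧
      (N : ℝ) ^ (k + 1) / 8 ≤ count (alive k ω) (k + 1) y}

/-- The `(k + 1)`-ball of `x` passes the test, so that its points alive at level `k` stay alive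
at level `k + 1`. -/
def Good (k : ℕ) (ω : Config N) (x : HierGroup N) : Prop :=
  Linked k (alive k ω) ω x ∧ (N : ℝ) ^ (k + 1) / 8 ≤ count (alive k ω) (k + 1) x

theorem mem_alive_succ {k : ℕ} {ω : Config N} {y : HierGroup N} :
    y ∈ alive (k + 1) ω ↔ y ∈ alive k ω ∧ Good k ω y := Iff.rfl

@[simp]
theorem mem_alive_zero (ω : Config N) (y : HierGroup N) : y ∈ alive 0 ω := trivial

theorem alive_antitone (ω : Config N) : Antitone fun k => alive k ω :=
  antitone_nat_of_succ_le fun _ _ h => (mem_alive_succ.1 h).1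

theorem count_congr {A : Set (HierGroup N)} {k : ℕ} {x y : HierGroup N} (h : hdist x y ≤ k) :
    count A k x = count A k y := by
  rw [count, count, ballF_congr h]

theorem count_le (A : Set (HierGroup N)) (k : ℕ) (x : HierGroup N) : count A k x ≤ N ^ k := by
  classical
  exact (Finset.card_filter_le _ _).trans (card_ballF k x).le

theorem count_pos {A : Set (HierGroup N)} {k : ℕ} {x : HierGroup N} :
    0 < count A k x ↔ ∃ y ∈ A, hdist x y ≤ k := by
  simp [count, Finset.card_pos, Finset.Nonempty, and_comm]

theorem count_succ (A : Set (HierGroup N)) (k : ℕ) (x : HierGroup N) :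
    count A (k + 1) x = ∑ r ∈ centres k x, count A k r := by
  classical
  simp only [count, Finset.card_filter]
  exact sum_ballF_succ k x _

theorem Good.congr {k : ℕ} {ω : Config N} {x y : HierGroup N} (h : hdist x y ≤ k + 1)
    (hx : Good k ω x) : Good k ω y := by
  refine ⟨fun u hu w hw hyu hyw => hx.1 u hu w hw (hdist_le_trans h hyu) (hdist_le_trans h hyw), ?_⟩
  rw [← count_congr h]
  exact hx.2

theorem count_alive_succ_of_good {k : ℕ} {ω : Config N} {x : HierGroup N} (h : Good k ω x) :
    count (alive (k + 1) ω) (k + 1) x = count (alive k ω) (k + 1) x := by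
  classical
  rw [count, count]
  congr 1
  refine Finset.filter_congr fun y hy => ?_
  rw [mem_alive_succ]
  exact and_iff_left (h.congr (mem_ballF.1 hy))

theorem count_alive_succ_of_not_good {k : ℕ} {ω : Config N} {x : HierGroup N} (h : ¬ Good k ω x) :
    count (alive (k + 1) ω) (k + 1) x = 0 := by
  classical
  rw [count, Finset.card_eq_zero, Finset.filter_eq_empty_iff]
  intro y hy hya
  exact h ((mem_alive_succ.1 hya).2.congr (hdist_le_symm (mem_ballF.1 hy)))

theorem le_count_alive {k : ℕ} {ω : Config N} {x y : HierGroup N} (hy : y ∈ alive k ω)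
    (h : hdist x y ≤ k) : (N : ℝ) ^ k / 8 ≤ count (alive k ω) k x := by
  cases k with
  | zero =>
    have : 0 < count (alive 0 ω) 0 x := count_pos.2 ⟨y, hy, h⟩
    have : (1 : ℝ) ≤ count (alive 0 ω) 0 x := by exact_mod_cast this
    norm_num
    linarith
  | succ k =>
    have hg : Good k ω x := (mem_alive_succ.1 hy).2.congr (hdist_le_symm h)
    rw [count_alive_succ_of_good hg]
    exact hg.2

/-- The alive points of a ball are connected to each other. -/
theorem reachable_of_mem_alive {k : ℕ} {ω : Config N} {u w : HierGroup N} (hu : u ∈ alive k ω)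
    (hw : w ∈ alive k ω) (h : hdist u w ≤ k) : (randomGraph ω).Reachable u w := by
  induction k generalizing u w with
  | zero => rw [hdist_le_zero.1 h]
  | succ k ih =>
    rw [mem_alive_succ] at hu hw
    by_cases hk : hdist u w ≤ k
    · exact ih hu.1 hw.1 hk
    · obtain ⟨u', hu', w', hw', huu, hww, he⟩ :=
        hu.2.1 u hu.1 w hw.1 (by simp) h (not_le.1 hk)
      have hne : u' ≠ w' := by
        rintro rfl
        have := lt_hdist_of_le (not_le.1 hk) huu hww
        simp at this
      have hadj : (randomGraph ω).Adj u' w' := ⟨hne, he⟩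
      exact (ih hu.1 hu' huu).trans (hadj.reachable.trans (ih hw.1 hw' hww).symm)

/-- The unordered pairs of points of the `k`-ball of `x`. -/
def edgesIn (k : ℕ) (x : HierGroup N) : Finset (Sym2 (HierGroup N)) := (ballF k x).sym2

theorem mk_mem_edgesIn {k : ℕ} {x y z : HierGroup N} :
    s(y, z) ∈ edgesIn k x ↔ hdist x y ≤ k ∧ hdist x z ≤ k := by
  simp [edgesIn]

theorem edgesIn_subset {j k : ℕ} {x y : HierGroup N} (hjk : j ≤ k) (h : hdist x y ≤ k) :
    edgesIn j y ⊆ edgesIn k x :=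
  Finset.sym2_mono (ballF_subset hjk h)

theorem disjoint_edgesIn {k : ℕ} {x y : HierGroup N} (h : k < hdist x y) :
    Disjoint (edgesIn k x) (edgesIn k y) := by
  rw [Finset.disjoint_left]
  intro e
  induction e with
  | _ a b =>
    rw [mk_mem_edgesIn, mk_mem_edgesIn]
    rintro ⟨hx, -⟩ ⟨hy, -⟩
    exact Finset.disjoint_left.1 (disjoint_ballF h) (mem_ballF.2 hx) (mem_ballF.2 hy)

theorem count_agree {A B : Set (HierGroup N)} {k : ℕ} {x : HierGroup N}
    (h : ∀ y, hdist x y ≤ k → (y ∈ A ↔ y ∈ B)) : count A k x = count B k x := by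
  classical
  rw [count, count]
  congr 1
  exact Finset.filter_congr fun y hy => h y (mem_ballF.1 hy)

theorem Linked.agree {A B : Set (HierGroup N)} {k : ℕ} {x : HierGroup N} {ω ω' : Config N}
    (h : ∀ y, hdist x y ≤ k + 1 → (y ∈ A ↔ y ∈ B))
    (hω : ∀ e ∈ edgesIn (k + 1) x, ω e = ω' e) (hA : Linked k A ω x) : Linked k B ω' x := by
  intro u hu w hw hxu hxw huw
  obtain ⟨u', hu', w', hw', huu, hww, he⟩ :=
    hA u ((h u hxu).2 hu) w ((h w hxw).2 hw) hxu hxw huw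
  have hxu' := hdist_le_trans hxu (huu.trans k.le_succ)
  have hxw' := hdist_le_trans hxw (hww.trans k.le_succ)
  exact ⟨u', (h u' hxu').1 hu', w', (h w' hxw').1 hw', huu, hww,
    hω _ (mk_mem_edgesIn.2 ⟨hxu', hxw'⟩) ▸ he⟩

theorem alive_agree {k : ℕ} {x : HierGroup N} {ω ω' : Config N}
    (hω : ∀ e ∈ edgesIn k x, ω e = ω' e) {y : HierGroup N} (hy : hdist x y ≤ k) :
    y ∈ alive k ω ↔ y ∈ alive k ω' := by
  induction k generalizing x y with
  | zero => simp
  | succ k ih =>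
    have key : ∀ z, hdist y z ≤ k + 1 → (z ∈ alive k ω ↔ z ∈ alive k ω') := fun z hz =>
      ih (x := z) (fun e he => hω e (edgesIn_subset k.le_succ (hdist_le_trans hy hz) he))
        (by simp)
    have hω' : ∀ e ∈ edgesIn (k + 1) y, ω e = ω' e := fun e he =>
      hω e (edgesIn_subset le_rfl hy he)
    rw [mem_alive_succ, mem_alive_succ, Good, Good, key y (by simp), count_agree key]
    refine and_congr_right fun _ => and_congr_left fun _ => ⟨fun h => h.agree key hω',
      fun h => h.agree (fun z hz => (key z hz).symm) fun e he => (hω' e he).symm⟩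

theorem alive_agree_of_le {j k : ℕ} (hjk : j ≤ k) {x : HierGroup N} {ω ω' : Config N}
    (hω : ∀ e ∈ edgesIn k x, ω e = ω' e) {y : HierGroup N} (hy : hdist x y ≤ k) :
    y ∈ alive j ω ↔ y ∈ alive j ω' :=
  alive_agree (x := y) (fun e he => hω e (edgesIn_subset hjk hy he)) (by simp)

theorem dependsOn_mem_alive (k : ℕ) {x y : HierGroup N} (h : hdist x y ≤ k) :
    DependsOn (fun ω : Config N => y ∈ alive k ω) (edgesIn k x : Set (Sym2 (HierGroup N))) :=
  fun _ _ hω => propext (alive_agree hω h)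

theorem dependsOn_count_alive {j k : ℕ} (hjk : j ≤ k) (x : HierGroup N) :
    DependsOn (fun ω : Config N => count (alive j ω) k x)
      (edgesIn k x : Set (Sym2 (HierGroup N))) :=
  fun _ _ hω => count_agree fun _ hy => alive_agree_of_le hjk hω hy

theorem dependsOn_linked_alive (k : ℕ) (x : HierGroup N) :
    DependsOn (fun ω : Config N => Linked k (alive k ω) ω x)
      (edgesIn (k + 1) x : Set (Sym2 (HierGroup N))) := fun _ _ hω =>
  have key := fun _ hy => alive_agree_of_le k.le_succ hω hy
  propext ⟨fun h => h.agree key hω,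
    fun h => h.agree (fun z hz => (key z hz).symm) fun e he => (hω e he).symm⟩

/-! ### Linking the subballs -/

open Classical in
/-- The points of `A` in the `k`-ball of `x`. -/
def trace (A : Set (HierGroup N)) (k : ℕ) (x : HierGroup N) : Finset (HierGroup N) :=
  (ballF k x).filter (· ∈ A)

theorem mem_trace {A : Set (HierGroup N)} {k : ℕ} {x y : HierGroup N} :
    y ∈ trace A k x ↔ hdist x y ≤ k ∧ y ∈ A := by
  simp [trace]

theorem card_trace (A : Set (HierGroup N)) (k : ℕ) (x : HierGroup N) :
    (trace A k x).card = count A k x := rfl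

theorem dependsOn_trace_alive (k : ℕ) (x : HierGroup N) :
    DependsOn (fun ω : Config N => trace (alive k ω) k x)
      (edgesIn k x : Set (Sym2 (HierGroup N))) := fun ω ω' hω => by
  ext y
  rw [mem_trace, mem_trace]
  exact and_congr_right fun hy => alive_agree hω hy

open Classical in
/-- The pairs with one point in `U` and one in `W`. -/
def edgesBetween (U W : Finset (HierGroup N)) : Finset (Sym2 (HierGroup N)) :=
  (U ×ˢ W).image fun p => s(p.1, p.2)

omit [NeZero N] in
theorem mem_edgesBetween {U W : Finset (HierGroup N)} {e : Sym2 (HierGroup N)} :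
    e ∈ edgesBetween U W ↔ ∃ u ∈ U, ∃ w ∈ W, s(u, w) = e := by
  simp only [edgesBetween, Finset.mem_image, Finset.mem_product, Prod.exists]
  exact ⟨fun ⟨u, w, h, he⟩ => ⟨u, h.1, w, h.2, he⟩, fun ⟨u, hu, w, hw, he⟩ => ⟨u, w, ⟨hu, hw⟩, he⟩⟩

omit [NeZero N] in
theorem card_edgesBetween {U W : Finset (HierGroup N)} (h : Disjoint U W) :
    (edgesBetween U W).card = U.card * W.card := by
  classical
  rw [← Finset.card_product, edgesBetween, Finset.card_image_of_injOn]
  rintro ⟨u, w⟩ hp ⟨u', w'⟩ hp' he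
  simp only [Finset.coe_product, Set.mem_prod, Finset.mem_coe] at hp hp'
  rcases Sym2.eq_iff.1 he with ⟨rfl, rfl⟩ | ⟨rfl, rfl⟩
  · rfl
  · exact absurd hp'.2 (Finset.disjoint_left.1 h hp.1)

/-- Two large sets in different `k`-balls of a `(k + 1)`-ball are unlikely to have no open edge
between them, since all the pairs between them are at distance exactly `k + 1`. -/
theorem percMeasure_closed_between_le {c : ℕ → ℝ} {k : ℕ} (hc : 0 ≤ c (k + 1))
    {r s : HierGroup N} (hrs : k < hdist r s) (hrs' : hdist r s ≤ k + 1)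
    {U W : Finset (HierGroup N)} (hU : U ⊆ ballF k r) (hW : W ⊆ ballF k s)
    (hUc : (N : ℝ) ^ k / 8 ≤ U.card) (hWc : (N : ℝ) ^ k / 8 ≤ W.card) :
    percMeasure N c {ω | ∀ e ∈ edgesBetween U W, ω e = false} ≤
      ENNReal.ofReal (Real.exp (-(c (k + 1) / (64 * (N : ℝ) ^ 2)))) := by
  have hN : (0 : ℝ) < N := by exact_mod_cast NeZero.pos N
  have hlt : ∀ u ∈ U, ∀ w ∈ W, k < hdist u w := fun u hu w hw =>
    lt_hdist_of_le hrs (mem_ballF.1 (hU hu)) (mem_ballF.1 (hW hw))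
  have hlen : ∀ e ∈ edgesBetween U W, edgeLength e = k + 1 := by
    intro e he
    obtain ⟨u, hu, w, hw, rfl⟩ := mem_edgesBetween.1 he
    refine le_antisymm ?_ (hlt u hu w hw)
    exact hdist_le_trans ((hdist_le_symm (mem_ballF.1 (hU hu))).trans k.le_succ)
      (hdist_le_trans hrs' ((mem_ballF.1 (hW hw)).trans k.le_succ))
  have hcard : (edgesBetween U W).card = U.card * W.card :=
    card_edgesBetween ((disjoint_ballF hrs).mono hU hW)
  rw [percMeasure_closed, Finset.prod_congr rfl fun e he => by rw [hlen e he], Finset.prod_const,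
    hcard, ← ENNReal.ofReal_pow (sub_nonneg.2 (connProb N c (k + 1)).2.2)]
  refine ENNReal.ofReal_le_ofReal ((pow_le_pow_left₀ (sub_nonneg.2 (connProb N c (k + 1)).2.2)
    (one_sub_connProb_le c (k + 1)) _).trans ?_)
  rw [← Real.exp_nat_mul, Real.exp_le_exp, mul_neg, neg_le_neg_iff]
  have h64 : ((N : ℝ) ^ k / 8) * ((N : ℝ) ^ k / 8) ≤ ((U.card * W.card : ℕ) : ℝ) := by
    push_cast
    exact mul_le_mul hUc hWc (by positivity) (by positivity)
  refine le_trans (le_of_eq ?_) (mul_le_mul_of_nonneg_right h64 (by positivity))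
  field_simp
  ring

/-- The `k`-balls of `r` and `s` have alive points, none of which are joined by an open edge. -/
def Unlinked (k : ℕ) (ω : Config N) (r s : HierGroup N) : Prop :=
  (∃ u ∈ alive k ω, hdist r u ≤ k) ∧ (∃ w ∈ alive k ω, hdist s w ≤ k) ∧
    ∀ u ∈ alive k ω, ∀ w ∈ alive k ω, hdist r u ≤ k → hdist s w ≤ k → ω s(u, w) = false

theorem percMeasure_unlinked_le {c : ℕ → ℝ} {k : ℕ} (hc : 0 ≤ c (k + 1))
    {r s : HierGroup N} (hrs : k < hdist r s) (hrs' : hdist r s ≤ k + 1) :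
    percMeasure N c {ω | Unlinked k ω r s} ≤
      ENNReal.ofReal (Real.exp (-(c (k + 1) / (64 * (N : ℝ) ^ 2)))) := by
  classical
  -- Condition on the sets of alive points in the two balls.
  set I : Finset (Sym2 (HierGroup N)) := edgesIn k r ∪ edgesIn k s with hI
  let O : Finset (HierGroup N) × Finset (HierGroup N) → Set (Config N) := fun p =>
    {ω | trace (alive k ω) k r = p.1 ∧ trace (alive k ω) k s = p.2 ∧
      (N : ℝ) ^ k / 8 ≤ p.1.card ∧ (N : ℝ) ^ k / 8 ≤ p.2.card}
  let D : Finset (HierGroup N) × Finset (HierGroup N) → Set (Config N) := fun p =>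
    {ω | ∀ e ∈ edgesBetween p.1 p.2, ω e = false}
  have key := measure_inter_le_mul_of_cover (μ := percMeasure N c)
    (cyl_le (I : Set (Sym2 (HierGroup N)))) (O := O) (D := D) (W := {ω | Unlinked k ω r s})
    (c := ENNReal.ofReal (Real.exp (-(c (k + 1) / (64 * (N : ℝ) ^ 2))))) ?_ ?_ ?_ ?_
    (E := Set.univ) MeasurableSet.univ
  · simpa using key
  · rintro ⟨U, W⟩
    refine measurableSet_cyl_of_dependsOn fun ω ω' hω => ?_
    have h1 := dependsOn_trace_alive k r fun e he => hω e (Finset.coe_subset.2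
      Finset.subset_union_left he)
    have h2 := dependsOn_trace_alive k s fun e he => hω e (Finset.coe_subset.2
      Finset.subset_union_right he)
    simp only at h1 h2
    simp only [h1, h2]
  · rintro ⟨U, W⟩ E hE hEO
    rcases E.eq_empty_or_nonempty with rfl | ⟨ω, hω⟩
    · simp
    obtain ⟨hU, hW, hUc, hWc⟩ := hEO hω
    simp only at hU hW hUc hWc
    have hUs : U ⊆ ballF k r := hU ▸ Finset.filter_subset _ _
    have hWs : W ⊆ ballF k s := hW ▸ Finset.filter_subset _ _
    have hdis : Disjoint (I : Set (Sym2 (HierGroup N))) (edgesBetween U W) := by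
      rw [Finset.disjoint_coe, Finset.disjoint_right]
      intro e he heI
      obtain ⟨u, hu, w, hw, rfl⟩ := mem_edgesBetween.1 he
      have hd := Finset.disjoint_left.1 (disjoint_ballF hrs)
      rcases Finset.mem_union.1 heI with h | h <;> rw [mk_mem_edgesIn] at h
      · exact hd (mem_ballF.2 h.2) (hWs hw)
      · exact hd (hUs hu) (mem_ballF.2 h.1)
    have hD : MeasurableSet[cyl (edgesBetween U W)] (D (U, W)) :=
      measurableSet_cyl_of_dependsOn fun ω ω' hω => by
        refine propext (forall₂_congr fun e he => ?_)
        rw [hω e he]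
    rw [(Indep_iff _ _ _).1 (indep_cyl c hdis) E _ hE hD, mul_comm]
    gcongr
    exact percMeasure_closed_between_le hc hrs hrs' hUs hWs hUc hWc
  · rintro ω ⟨⟨u, hu, hru⟩, ⟨w, hw, hsw⟩, -⟩
    exact Set.mem_iUnion.2 ⟨(trace (alive k ω) k r, trace (alive k ω) k s), rfl, rfl,
      le_count_alive hu hru, le_count_alive hw hsw⟩
  · rintro ⟨U, W⟩ ω ⟨⟨-, -, h⟩, hU, hW, -⟩ e he
    obtain ⟨u, hu, w, hw, rfl⟩ := mem_edgesBetween.1 he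
    simp only at hU hW hu hw
    rw [← hU, mem_trace] at hu
    rw [← hW, mem_trace] at hw
    exact h u hu.2 w hw.2 hu.1 hw.1

/-- The bound on the probability that the `k`-balls of a `(k + 1)`-ball are not linked. -/
def linkError (N : ℕ) (c : ℕ → ℝ) (k : ℕ) : ℝ :=
  (N : ℝ) ^ 2 * Real.exp (-(c (k + 1) / (64 * (N : ℝ) ^ 2)))

omit [NeZero N] in
theorem linkError_nonneg (c : ℕ → ℝ) (k : ℕ) : 0 ≤ linkError N c k := by
  unfold linkError; positivity

theorem percMeasure_not_linked_le {c : ℕ → ℝ} {k : ℕ} (hc : 0 ≤ c (k + 1)) (x : HierGroup N) :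
    (percMeasure N c).real {ω | ¬ Linked k (alive k ω) ω x} ≤ linkError N c k := by
  classical
  set δ := Real.exp (-(c (k + 1) / (64 * (N : ℝ) ^ 2))) with hδ
  have hsub : {ω : Config N | ¬ Linked k (alive k ω) ω x} ⊆
      ⋃ p ∈ (centres k x).offDiag, {ω | Unlinked k ω p.1 p.2} := by
    intro ω hω
    simp only [Set.mem_ofPred_eq, Linked, not_forall, exists_prop] at hω
    obtain ⟨u, hu, w, hw, hxu, hxw, huw, hno⟩ := hω
    refine Set.mem_iUnion₂.2 ⟨(centre k u, centre k w), ?_, ⟨u, hu, hdist_centre_le k u⟩,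
      ⟨w, hw, hdist_centre_le k w⟩, fun u' hu' w' hw' h1 h2 => ?_⟩
    · rw [Finset.mem_offDiag]
      refine ⟨centre_mem_centres hxu, centre_mem_centres hxw, fun h => ?_⟩
      exact absurd (centre_eq_iff.1 h) (by omega)
    · by_contra hne
      exact hno ⟨u', hu', w', hw', hdist_le_trans (hdist_le_symm (hdist_centre_le k u)) h1,
        hdist_le_trans (hdist_le_symm (hdist_centre_le k w)) h2, by simpa using hne⟩
  calc (percMeasure N c).real {ω | ¬ Linked k (alive k ω) ω x}
      ≤ ∑ p ∈ (centres k x).offDiag, (percMeasure N c).real {ω | Unlinked k ω p.1 p.2} :=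
        (measureReal_mono hsub (measure_ne_top _ _)).trans (measureReal_biUnion_finset_le _ _)
    _ ≤ ∑ _p ∈ (centres k x).offDiag, δ := by
        refine Finset.sum_le_sum fun p hp => ENNReal.toReal_le_of_le_ofReal (Real.exp_pos _).le ?_
        obtain ⟨h1, h2, h3⟩ := Finset.mem_offDiag.1 hp
        exact percMeasure_unlinked_le hc (lt_hdist_of_mem_centres h1 h2 h3)
          (hdist_le_trans (hdist_le_symm (hdist_le_of_mem_centres h1)) (hdist_le_of_mem_centres h2))
    _ ≤ (N : ℝ) ^ 2 * δ := by
        rw [Finset.sum_const, nsmul_eq_mul]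
        refine mul_le_mul_of_nonneg_right ?_ (Real.exp_pos _).le
        rw [Finset.offDiag_card, card_centres, sq]
        exact_mod_cast Nat.sub_le _ _

/-! ### The density of alive points -/

/-- The proportion of the points of the `k`-ball of `x` that are alive at level `j`. -/
def aliveDensity (j k : ℕ) (x : HierGroup N) (ω : Config N) : ℝ :=
  count (alive j ω) k x / (N : ℝ) ^ k

theorem aliveDensity_nonneg (j k : ℕ) (x : HierGroup N) (ω : Config N) :
    0 ≤ aliveDensity j k x ω := by unfold aliveDensity; positivity

theorem natCast_pow_pos (k : ℕ) : (0 : ℝ) < (N : ℝ) ^ k :=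
  pow_pos (by exact_mod_cast NeZero.pos N) k

theorem aliveDensity_le_one (j k : ℕ) (x : HierGroup N) (ω : Config N) :
    aliveDensity j k x ω ≤ 1 := by
  rw [aliveDensity, div_le_one (natCast_pow_pos k)]
  exact_mod_cast count_le _ k x

theorem measurable_aliveDensity {j k : ℕ} (hjk : j ≤ k) (x : HierGroup N) :
    Measurable[cyl (edgesIn k x)] (aliveDensity j k x : Config N → ℝ) :=
  measurable_cyl_of_dependsOn fun ω ω' hω => by
    have := dependsOn_count_alive hjk x hω
    simp only at this
    simp only [aliveDensity, this]

theorem memLp_aliveDensity (c : ℕ → ℝ) {j k : ℕ} (hjk : j ≤ k) (x : HierGroup N) (p : ENNReal) :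
    MemLp (aliveDensity j k x) p (percMeasure N c) :=
  MemLp.of_bound ((measurable_aliveDensity hjk x).mono (cyl_le _) le_rfl).aestronglyMeasurable 1
    (ae_of_all _ fun ω => by
      rw [Real.norm_of_nonneg (aliveDensity_nonneg j k x ω)]
      exact aliveDensity_le_one j k x ω)

theorem good_iff {k : ℕ} {ω : Config N} {x : HierGroup N} :
    Good k ω x ↔ Linked k (alive k ω) ω x ∧ 1 / 8 ≤ aliveDensity k (k + 1) x ω := by
  rw [Good, aliveDensity, le_div_iff₀ (natCast_pow_pos (k + 1)), div_eq_inv_mul, one_div]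

theorem aliveDensity_succ_of_good {k : ℕ} {ω : Config N} {x : HierGroup N} (h : Good k ω x) :
    aliveDensity (k + 1) (k + 1) x ω = aliveDensity k (k + 1) x ω := by
  rw [aliveDensity, aliveDensity, count_alive_succ_of_good h]

theorem aliveDensity_succ_of_not_good {k : ℕ} {ω : Config N} {x : HierGroup N}
    (h : ¬ Good k ω x) : aliveDensity (k + 1) (k + 1) x ω = 0 := by
  rw [aliveDensity, count_alive_succ_of_not_good h, Nat.cast_zero, zero_div]

theorem aliveDensity_eq_sum_centres (k : ℕ) (x : HierGroup N) :
    (aliveDensity k (k + 1) x : Config N → ℝ) =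
      fun ω => (N : ℝ)⁻¹ * (∑ r ∈ centres k x, aliveDensity k k r) ω := by
  funext ω
  simp only [aliveDensity, Finset.sum_apply, count_succ, Nat.cast_sum, ← Finset.sum_div, pow_succ]
  have := (natCast_pow_pos (N := N) k).ne'
  have : (N : ℝ) ≠ 0 := by exact_mod_cast NeZero.ne N
  field_simp

/-- The balls of diameter `k` are independent, so that averaging over the `N` subballs divides
the variance by `N`. -/
theorem variance_aliveDensity_le (c : ℕ → ℝ) {k : ℕ} {v : ℝ}
    (h : ∀ x : HierGroup N, variance (aliveDensity k k x) (percMeasure N c) ≤ v)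
    (x : HierGroup N) : variance (aliveDensity k (k + 1) x) (percMeasure N c) ≤ v / N := by
  rw [aliveDensity_eq_sum_centres, variance_const_mul, IndepFun.variance_sum]
  · have hN : (0 : ℝ) < N := by exact_mod_cast NeZero.pos N
    have : ∑ r ∈ centres k x, variance (aliveDensity k k r) (percMeasure N c) ≤ N * v := by
      refine (Finset.sum_le_sum fun r _ => h r).trans ?_
      rw [Finset.sum_const, card_centres, nsmul_eq_mul]
    refine (mul_le_mul_of_nonneg_left this (by positivity)).trans (le_of_eq ?_)
    field_simp
  · exact fun r _ => memLp_aliveDensity c le_rfl r 2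
  · intro r hr s hs hrs
    have hd := disjoint_edgesIn (lt_hdist_of_mem_centres hr hs hrs)
    exact indep_of_indep_of_le_left (indep_of_indep_of_le_right
      (indep_cyl c (Finset.disjoint_coe.2 hd))
      (measurable_aliveDensity le_rfl s).comap_le) (measurable_aliveDensity le_rfl r).comap_le

theorem measurableSet_mem_alive (k : ℕ) (y : HierGroup N) :
    MeasurableSet {ω : Config N | y ∈ alive k ω} :=
  measurableSet_of_dependsOn (dependsOn_mem_alive k (hdist_self y ▸ k.zero_le))

theorem le_integral_aliveDensity (c : ℕ → ℝ) {j k : ℕ} {a : ℝ}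
    (h : ∀ x : HierGroup N, a ≤ (percMeasure N c).real {ω | x ∈ alive j ω}) (x : HierGroup N) :
    a ≤ ∫ ω, aliveDensity j k x ω ∂percMeasure N c := by
  classical
  have h1 : ∀ ω : Config N, aliveDensity j k x ω =
      (∑ y ∈ ballF k x, {ω : Config N | y ∈ alive j ω}.indicator 1 ω) / (N : ℝ) ^ k := by
    intro ω
    rw [aliveDensity, count, Finset.card_filter]
    push_cast
    simp only [Set.indicator_apply, Set.mem_ofPred_eq, Pi.one_apply]
  simp_rw [h1]
  rw [integral_div, integral_finsetSum _ fun y _ =>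
    (integrable_indicator_iff (measurableSet_mem_alive j y)).2 (integrable_const 1).integrableOn,
    le_div_iff₀ (natCast_pow_pos k)]
  simp_rw [integral_indicator_one (measurableSet_mem_alive j _)]
  refine le_trans (le_of_eq ?_) (Finset.sum_le_sum fun y _ => h y)
  rw [Finset.sum_const, card_ballF, nsmul_eq_mul]
  push_cast
  ring

theorem measure_aliveDensity_lt_le (hN : 2 ≤ N) (c : ℕ → ℝ) {k : ℕ} {v : ℝ}
    (hv : ∀ x : HierGroup N, variance (aliveDensity k k x) (percMeasure N c) ≤ v)
    (hm : ∀ x : HierGroup N, 7 / 8 ≤ (percMeasure N c).real {ω | x ∈ alive k ω})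
    (x : HierGroup N) :
    (percMeasure N c).real {ω | aliveDensity k (k + 1) x ω < 1 / 8} ≤ 8 / 9 * v := by
  have hN' : (2 : ℝ) ≤ N := by exact_mod_cast hN
  have hv0 : 0 ≤ v := (variance_nonneg _ _).trans (hv x)
  have hvar := variance_aliveDensity_le c hv x
  have hint := le_integral_aliveDensity c (k := k + 1) hm x
  have hch := meas_ge_le_variance_div_sq (memLp_aliveDensity c k.le_succ x 2)
    (show (0 : ℝ) < 3 / 4 by norm_num)
  refine (measureReal_mono (fun ω hω => ?_) (measure_ne_top _ _)).trans
    ((ENNReal.toReal_le_of_le_ofReal (div_nonneg (variance_nonneg _ _) (by positivity))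
      hch).trans ?_)
  · simp only [Set.mem_ofPred_eq] at hω ⊢
    rw [abs_sub_comm]
    exact le_trans (by linarith) (le_abs_self _)
  · have : v / N ≤ v / 2 := div_le_div_of_nonneg_left hv0 (by norm_num) hN'
    rw [div_le_iff₀ (by norm_num)]
    linarith

theorem measure_not_good_le (hN : 2 ≤ N) {c : ℕ → ℝ} {k : ℕ} (hc : 0 ≤ c (k + 1)) {v : ℝ}
    (hv : ∀ x : HierGroup N, variance (aliveDensity k k x) (percMeasure N c) ≤ v)
    (hm : ∀ x : HierGroup N, 7 / 8 ≤ (percMeasure N c).real {ω | x ∈ alive k ω})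
    (x : HierGroup N) :
    (percMeasure N c).real {ω | ¬ Good k ω x} ≤ linkError N c k + v := by
  have hv0 : 0 ≤ v := (variance_nonneg _ _).trans (hv x)
  have hsub : {ω : Config N | ¬ Good k ω x} ⊆ {ω | ¬ Linked k (alive k ω) ω x} ∪
      {ω | aliveDensity k (k + 1) x ω < 1 / 8} := by
    intro ω hω
    by_contra h
    simp only [Set.mem_union, Set.mem_ofPred_eq, not_or, not_not, not_lt] at h
    exact hω (good_iff.2 h)
  have h1 := percMeasure_not_linked_le hc x
  have h2 := measure_aliveDensity_lt_le hN c hv hm x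
  have h3 := (measureReal_mono hsub (measure_ne_top (percMeasure N c) _)).trans
    (measureReal_union_le _ _)
  linarith

/-- The variance of the density at the next level: killing the points of a ball that is not linked
costs at most the probability of this event, and a ball that is not dense has little to lose. -/
theorem variance_aliveDensity_succ_le (hN : 2 ≤ N) {c : ℕ → ℝ} {k : ℕ} (hc : 0 ≤ c (k + 1)) {v : ℝ}
    (hv : ∀ x : HierGroup N, variance (aliveDensity k k x) (percMeasure N c) ≤ v)
    (hm : ∀ x : HierGroup N, 7 / 8 ≤ (percMeasure N c).real {ω | x ∈ alive k ω})
    (x : HierGroup N) :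
    variance (aliveDensity (k + 1) (k + 1) x) (percMeasure N c) ≤
      4 / 5 * v + 3 * linkError N c k := by
  set μ := percMeasure N c
  have hN' : (2 : ℝ) ≤ N := by exact_mod_cast hN
  have hv0 : 0 ≤ v := (variance_nonneg _ _).trans (hv x)
  have hvar := variance_aliveDensity_le c hv x
  have hvN : v / N ≤ v / 2 := div_le_div_of_nonneg_left hv0 (by norm_num) hN'
  have h1 := percMeasure_not_linked_le hc x
  have h2 := measure_aliveDensity_lt_le hN c hv hm x
  set m := ∫ ω, aliveDensity k (k + 1) x ω ∂μ with hmdef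
  have hY : Measurable (aliveDensity (k + 1) (k + 1) x : Config N → ℝ) :=
    (measurable_aliveDensity le_rfl x).mono (cyl_le _) le_rfl
  have hZ : Measurable (aliveDensity k (k + 1) x : Config N → ℝ) :=
    (measurable_aliveDensity k.le_succ x).mono (cyl_le _) le_rfl
  have hA : MeasurableSet {ω : Config N | ¬ Linked k (alive k ω) ω x} :=
    (measurableSet_of_dependsOn (dependsOn_linked_alive k x)).compl
  have hB : MeasurableSet {ω : Config N | aliveDensity k (k + 1) x ω < 1 / 8} :=
    measurableSet_lt hZ measurable_const
  have hpt : ∀ ω : Config N, (aliveDensity (k + 1) (k + 1) x ω - m) ^ 2 ≤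
      3 / 2 * (aliveDensity k (k + 1) x ω - m) ^ 2 +
        (3 * {ω : Config N | ¬ Linked k (alive k ω) ω x}.indicator 1 ω +
          3 / 64 * {ω : Config N | aliveDensity k (k + 1) x ω < 1 / 8}.indicator 1 ω) := by
    intro ω
    have hz0 := aliveDensity_nonneg k (k + 1) x ω
    have hz1 := aliveDensity_le_one k (k + 1) x ω
    have hi1 : 0 ≤ {ω : Config N | ¬ Linked k (alive k ω) ω x}.indicator (1 : Config N → ℝ) ω :=
      Set.indicator_nonneg (fun _ _ => zero_le_one) _
    have hi2 : 0 ≤ {ω : Config N | aliveDensity k (k + 1) x ω < 1 / 8}.indicator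
        (1 : Config N → ℝ) ω := Set.indicator_nonneg (fun _ _ => zero_le_one) _
    by_cases hg : Good k ω x
    · rw [aliveDensity_succ_of_good hg]
      nlinarith [sq_nonneg (aliveDensity k (k + 1) x ω - m)]
    · rw [aliveDensity_succ_of_not_good hg]
      -- `(a - b)² ≤ (3/2) a² + 3 b²`, with `b` the density lost at this step
      have hsq : (0 - m) ^ 2 ≤ 3 / 2 * (aliveDensity k (k + 1) x ω - m) ^ 2 +
          3 * aliveDensity k (k + 1) x ω ^ 2 := by
        nlinarith [sq_nonneg ((aliveDensity k (k + 1) x ω - m) + 2 * aliveDensity k (k + 1) x ω)]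
      by_cases hl : Linked k (alive k ω) ω x
      · have hd : aliveDensity k (k + 1) x ω < 1 / 8 := by
          by_contra hd
          exact hg (good_iff.2 ⟨hl, not_lt.1 hd⟩)
        rw [Set.indicator_of_mem (s := {ω | aliveDensity k (k + 1) x ω < 1 / 8}) hd]
        simp only [Pi.one_apply]
        nlinarith
      · rw [Set.indicator_of_mem (s := {ω | ¬ Linked k (alive k ω) ω x}) hl]
        simp only [Pi.one_apply]
        nlinarith
  have hi1 : Integrable ({ω : Config N | ¬ Linked k (alive k ω) ω x}.indicator (1 : Config N → ℝ))
      μ := (integrable_indicator_iff hA).2 (integrable_const 1).integrableOn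
  have hi2 : Integrable ({ω : Config N | aliveDensity k (k + 1) x ω < 1 / 8}.indicator
      (1 : Config N → ℝ)) μ := (integrable_indicator_iff hB).2 (integrable_const 1).integrableOn
  have hi3 : Integrable (fun ω => (aliveDensity k (k + 1) x ω - m) ^ 2) μ :=
    ((memLp_aliveDensity c k.le_succ x 2).sub (memLp_const m)).integrable_sq
  have hi4 : Integrable (fun ω => (aliveDensity (k + 1) (k + 1) x ω - m) ^ 2) μ :=
    ((memLp_aliveDensity c le_rfl x 2).sub (memLp_const m)).integrable_sq
  calc variance (aliveDensity (k + 1) (k + 1) x) μ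
      = variance (fun ω => aliveDensity (k + 1) (k + 1) x ω - m) μ :=
        (variance_sub_const hY.aestronglyMeasurable m).symm
    _ ≤ ∫ ω, (aliveDensity (k + 1) (k + 1) x ω - m) ^ 2 ∂μ :=
        variance_le_expectation_sq (hY.sub_const m).aestronglyMeasurable
    _ ≤ _ := integral_mono hi4 ((hi3.const_mul _).add
        ((hi1.const_mul 3).add (hi2.const_mul (3 / 64)))) hpt
    _ = 3 / 2 * variance (aliveDensity k (k + 1) x) μ +
        (3 * μ.real {ω | ¬ Linked k (alive k ω) ω x} +
          3 / 64 * μ.real {ω | aliveDensity k (k + 1) x ω < 1 / 8}) := by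
        rw [integral_add' (hi3.const_mul _) ((hi1.const_mul 3).add (hi2.const_mul (3 / 64))),
          integral_add' (hi1.const_mul 3) (hi2.const_mul (3 / 64)), integral_const_mul,
          integral_const_mul, integral_const_mul, integral_indicator_one hA,
          integral_indicator_one hB, variance_eq_integral hZ.aemeasurable]
    _ ≤ 4 / 5 * v + 3 * linkError N c k := by linarith

/-- The bound on the variance of the density of alive points in a ball of diameter `k`. -/
def varBound (N : ℕ) (c : ℕ → ℝ) : ℕ → ℝ
  | 0 => 0
  | k + 1 => 4 / 5 * varBound N c k + 3 * linkError N c k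

omit [NeZero N] in
theorem varBound_nonneg (c : ℕ → ℝ) (k : ℕ) : 0 ≤ varBound N c k := by
  induction k with
  | zero => exact le_rfl
  | succ k ih =>
    have := linkError_nonneg (N := N) c k
    rw [varBound]; positivity

/-- The bound on the probability that a ball of diameter `k + 1` is not good. -/
def killBound (N : ℕ) (c : ℕ → ℝ) (k : ℕ) : ℝ := linkError N c k + varBound N c k

omit [NeZero N] in
theorem killBound_nonneg (c : ℕ → ℝ) (k : ℕ) : 0 ≤ killBound N c k :=
  add_nonneg (linkError_nonneg c k) (varBound_nonneg c k)

omit [NeZero N] in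
theorem sum_killBound_le (c : ℕ → ℝ) (n : ℕ) :
    ∑ k ∈ Finset.range n, killBound N c k ≤ 16 * ∑ k ∈ Finset.range n, linkError N c k := by
  -- Since `varBound` contracts by `4 / 5`, the term `5 * varBound` makes the sum telescope.
  suffices h : ∑ k ∈ Finset.range n, killBound N c k + 5 * varBound N c n ≤
      16 * ∑ k ∈ Finset.range n, linkError N c k by
    have := varBound_nonneg (N := N) c n
    linarith
  induction n with
  | zero => simp [varBound]
  | succ n ih =>
    rw [Finset.sum_range_succ, Finset.sum_range_succ, varBound, killBound]
    linarith

/-- The variance of the density of alive points and the probability to be alive have to be bounded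
together: each step of the recursion for the one uses the bound on the other. -/
theorem alive_bounds (hN : 2 ≤ N) {c : ℕ → ℝ} (hc : ∀ k, 0 ≤ c (k + 1))
    (hsum : ∀ n, ∑ k ∈ Finset.range n, linkError N c k ≤ 1 / 128) (k : ℕ) :
    (∀ x : HierGroup N, variance (aliveDensity k k x) (percMeasure N c) ≤ varBound N c k) ∧
    ∀ x : HierGroup N, 1 - ∑ j ∈ Finset.range k, killBound N c j ≤
      (percMeasure N c).real {ω | x ∈ alive k ω} := by
  induction k with
  | zero =>
    refine ⟨fun x => ?_, fun x => by simp⟩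
    have : (aliveDensity 0 0 x : Config N → ℝ) = fun _ => 1 := by
      funext ω
      refine le_antisymm (aliveDensity_le_one _ _ _ _) ?_
      have : 0 < count (alive 0 ω) 0 x := count_pos.2 ⟨x, by simp, by simp⟩
      simp only [aliveDensity, pow_zero, div_one]
      exact_mod_cast this
    rw [this]
    simp [variance, evariance, varBound]
  | succ k ih =>
    obtain ⟨hv, hm⟩ := ih
    have hm' : ∀ x : HierGroup N, 7 / 8 ≤ (percMeasure N c).real {ω | x ∈ alive k ω} := fun x => by
      have h1 := sum_killBound_le (N := N) c k
      have h2 := hsum k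
      have h3 := hm x
      linarith
    refine ⟨variance_aliveDensity_succ_le hN (hc k) hv hm', fun x => ?_⟩
    have h1 := measure_not_good_le hN (hc k) hv hm' x
    have h2 : (percMeasure N c).real {ω | x ∈ alive k ω} ≤
        (percMeasure N c).real {ω | x ∈ alive (k + 1) ω} +
          (percMeasure N c).real {ω | ¬ Good k ω x} := by
      refine (measureReal_mono (fun ω hω => ?_) (measure_ne_top _ _)).trans
        (measureReal_union_le _ _)
      by_cases hg : Good k ω x
      · exact Or.inl ⟨hω, hg⟩
      · exact Or.inr hg
    have h3 := hm x
    rw [Finset.sum_range_succ]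
    simp only [killBound] at h3 ⊢
    linarith

theorem seven_eighths_le_measure_alive (hN : 2 ≤ N) {c : ℕ → ℝ} (hc : ∀ k, 0 ≤ c (k + 1))
    (hsum : ∀ n, ∑ k ∈ Finset.range n, linkError N c k ≤ 1 / 128) (k : ℕ) (x : HierGroup N) :
    7 / 8 ≤ (percMeasure N c).real {ω | x ∈ alive k ω} := by
  have h1 := sum_killBound_le (N := N) c k
  have h2 := hsum k
  have h3 := (alive_bounds hN hc hsum k).2 x
  linarith

/-- By the Borel–Cantelli lemma, all large balls around the origin are good. -/
theorem ae_eventually_good (hN : 2 ≤ N) {c : ℕ → ℝ} (hc : ∀ k, 0 ≤ c (k + 1))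
    (hsum : ∀ n, ∑ k ∈ Finset.range n, linkError N c k ≤ 1 / 128) :
    ∀ᵐ ω ∂percMeasure N c, ∀ᶠ k in atTop, Good k ω 0 := by
  have hs : Summable (killBound N c) :=
    summable_of_sum_range_le (c := 1 / 8) (killBound_nonneg c) fun n => by
      have h1 := sum_killBound_le (N := N) c n
      have h2 := hsum n
      linarith
  have h := ae_eventually_notMem (μ := percMeasure N c) (s := fun k => {ω | ¬ Good k ω 0}) ?_
  · filter_upwards [h] with ω hω
    filter_upwards [hω] with k hk
    exact not_not.1 hk
  · refine ne_top_of_le_ne_top hs.tsum_ofReal_ne_top (ENNReal.tsum_le_tsum fun k => ?_)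
    rw [← ofReal_measureReal (measure_ne_top _ _)]
    exact ENNReal.ofReal_le_ofReal (measure_not_good_le hN (hc k) (alive_bounds hN hc hsum k).1
      (seven_eighths_le_measure_alive hN hc hsum k) 0)

/-! ### Infinite clusters of a configuration -/

/-- The set of the vertices whose cluster is infinite. -/
def infSet (ω : Config N) : Set (HierGroup N) :=
  {x | {y | (randomGraph ω).Reachable x y}.Infinite}

open Classical in
/-- The configuration in which all pairs that are not inside the `n`-ball of the origin are
closed. -/
def restrictBall (n : ℕ) (ω : Config N) : Config N :=
  fun e => if e ∈ edgesIn n 0 then ω e else false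

theorem restrictBall_apply_eq_true {n : ℕ} {ω : Config N} {e : Sym2 (HierGroup N)} :
    restrictBall n ω e = true ↔ e ∈ edgesIn n 0 ∧ ω e = true := by
  simp [restrictBall]

theorem randomGraph_restrictBall_mono (ω : Config N) :
    Monotone fun n => randomGraph (restrictBall n ω) := by
  intro m n hmn x y h
  refine ⟨h.1, ?_⟩
  have := restrictBall_apply_eq_true.1 h.2
  exact restrictBall_apply_eq_true.2 ⟨edgesIn_subset hmn (by simp) this.1, this.2⟩

theorem randomGraph_restrictBall_le (n : ℕ) (ω : Config N) :
    randomGraph (restrictBall n ω) ≤ randomGraph ω :=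
  fun _ _ h => ⟨h.1, (restrictBall_apply_eq_true.1 h.2).2⟩

theorem reachable_iff_exists_restrictBall {ω : Config N} {x y : HierGroup N} :
    (randomGraph ω).Reachable x y ↔ ∃ n, (randomGraph (restrictBall n ω)).Reachable x y := by
  constructor
  · rintro ⟨p⟩
    induction p with
    | nil => exact ⟨0, SimpleGraph.Reachable.refl _⟩
    | @cons u v w h p ih =>
      obtain ⟨n, hn⟩ := ih
      set m := max n (max (hdist 0 u) (hdist 0 v))
      have hadj : (randomGraph (restrictBall m ω)).Adj u v :=
        ⟨h.1, restrictBall_apply_eq_true.2 ⟨mk_mem_edgesIn.2 ⟨by omega, by omega⟩, h.2⟩⟩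
      exact ⟨m, hadj.reachable.trans
        (hn.mono (randomGraph_restrictBall_mono ω (le_max_left _ _)))⟩
  · rintro ⟨n, hn⟩
    exact hn.mono (randomGraph_restrictBall_le n ω)

theorem dependsOn_reachable_restrictBall (n : ℕ) (x y : HierGroup N) :
    DependsOn (fun ω : Config N => (randomGraph (restrictBall n ω)).Reachable x y)
      (edgesIn n (0 : HierGroup N) : Set (Sym2 (HierGroup N))) := fun ω ω' hω => by
  have : restrictBall n ω = restrictBall n ω' := by
    funext e
    simp only [restrictBall]
    split_ifs with he
    exacts [hω e he, rfl]
  simp only [this]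

/-- An infinite cluster leaves every ball that it meets. -/
theorem exists_exit {ω : Config N} {x : HierGroup N} (hx : x ∈ infSet ω) {n : ℕ}
    (hn : hdist 0 x ≤ n) : ∃ y z, hdist 0 y ≤ n ∧ n < hdist 0 z ∧
      (randomGraph (restrictBall n ω)).Reachable x y ∧ ω s(y, z) = true := by
  by_contra! hno
  refine hx ((ballF n 0).finite_toSet.subset fun y hy => ?_)
  suffices h : hdist 0 y ≤ n ∧ (randomGraph (restrictBall n ω)).Reachable x y from
    mem_ballF.2 h.1
  have hy' := (SimpleGraph.reachable_iff_reflTransGen x y).1 hy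
  induction hy' with
  | refl => exact ⟨hn, SimpleGraph.Reachable.refl _⟩
  | @tail a b hxa hab ih =>
    obtain ⟨ha, hra⟩ := ih ((SimpleGraph.reachable_iff_reflTransGen x a).2 hxa)
    have hb : hdist 0 b ≤ n := by
      by_contra hb
      exact hno a b ha (not_le.1 hb) hra hab.2
    have hadj : (randomGraph (restrictBall n ω)).Adj a b :=
      ⟨hab.1, restrictBall_apply_eq_true.2 ⟨mk_mem_edgesIn.2 ⟨ha, hb⟩, hab.2⟩⟩
    exact ⟨hb, hra.trans hadj.reachable⟩

theorem mem_infSet_of_forall_alive (hN : 2 ≤ N) {ω : Config N} {K : ℕ} {z : HierGroup N}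
    (h : ∀ k, K ≤ k → z ∈ alive k ω) : z ∈ infSet ω := by
  intro hfin
  have hN' : (1 : ℝ) < N := by exact_mod_cast hN
  obtain ⟨k, hk⟩ := ((tendsto_pow_atTop_atTop_of_one_lt hN').eventually_gt_atTop
    (8 * (hfin.toFinset.card : ℝ)) |>.and (eventually_ge_atTop K)).exists
  have hcard : count (alive k ω) k z ≤ hfin.toFinset.card := by
    rw [← card_trace]
    refine Finset.card_le_card fun y hy => ?_
    rw [mem_trace] at hy
    exact hfin.mem_toFinset.2 (reachable_of_mem_alive (h k hk.2) hy.2 hy.1)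
  have h1 := le_count_alive (h k hk.2) (x := z) (by simp)
  have h2 : (count (alive k ω) k z : ℝ) ≤ hfin.toFinset.card := by exact_mod_cast hcard
  linarith [hk.1]

theorem mem_alive_of_good {ω : Config N} {K : ℕ} (hω : ∀ k, K ≤ k → Good k ω 0) {j : ℕ}
    (hj : K ≤ j) {z : HierGroup N} (hz : z ∈ alive j ω) (hz0 : hdist 0 z ≤ j + 1) {i : ℕ}
    (hi : j ≤ i) : z ∈ alive i ω := by
  induction i, hi using Nat.le_induction with
  | base => exact hz
  | succ i hi ih => exact mem_alive_succ.2 ⟨ih, (hω i (hj.trans hi)).congr (by omega)⟩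

theorem reachable_of_good {ω : Config N} {K : ℕ} (hω : ∀ k, K ≤ k → Good k ω 0) {i j : ℕ}
    (hi : K ≤ i) (hj : K ≤ j) {y z : HierGroup N} (hy : y ∈ alive i ω) (hy0 : hdist 0 y ≤ i + 1)
    (hz : z ∈ alive j ω) (hz0 : hdist 0 z ≤ j + 1) : (randomGraph ω).Reachable y z := by
  have hy' := mem_alive_of_good hω hi hy hy0 (i := max i j + 1) (by omega)
  have hz' := mem_alive_of_good hω hj hz hz0 (i := max i j + 1) (by omega)
  exact reachable_of_mem_alive hy' hz'
    (hdist_le_trans (hdist_le_symm (hy0.trans (by omega))) (hz0.trans (by omega)))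

theorem exists_alive_of_good {ω : Config N} {k : ℕ} (h : Good k ω 0) :
    ∃ z ∈ alive k ω, hdist 0 z ≤ k + 1 := by
  refine count_pos.1 ?_
  have h1 : (0 : ℝ) < count (alive k ω) (k + 1) 0 :=
    lt_of_lt_of_le (div_pos (natCast_pow_pos (k + 1)) (by norm_num)) h.2
  exact_mod_cast h1

theorem le_count_infSet_of_good (hN : 2 ≤ N) {ω : Config N} {K : ℕ}
    (hω : ∀ k, K ≤ k → Good k ω 0) {k : ℕ} (hk : K ≤ k) :
    (N : ℝ) ^ (k + 1) / 8 ≤ count (infSet ω) (k + 1) 0 := by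
  classical
  refine (hω k hk).2.trans ?_
  rw [Nat.cast_le, ← card_trace, ← card_trace]
  refine Finset.card_le_card fun y hy => ?_
  rw [mem_trace] at hy ⊢
  exact ⟨hy.1, mem_infSet_of_forall_alive hN fun i hi => mem_alive_of_good hω hk hy.2 hy.1 hi⟩

/-! ### Uniqueness -/

/-- The cluster of `x` in the `n`-ball of the origin has an open edge from `p.1`, in the ball, to
`p.2`, outside the ball. -/
def exitSet (x : HierGroup N) (n : ℕ) (p : HierGroup N × HierGroup N) : Set (Config N) :=
  {ω | hdist 0 p.1 ≤ n ∧ n < hdist 0 p.2 ∧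
    (randomGraph (restrictBall n ω)).Reachable x p.1 ∧ ω s(p.1, p.2) = true}

/-- The point `z` is not alive at the level of the largest ball around it that avoids the
origin. -/
def deadSet (z : HierGroup N) : Set (Config N) := {ω | z ∉ alive (hdist 0 z - 1) ω}

/-- All edges by which the cluster of `x` in the `n`-ball of the origin leaves the ball end in dead
points, and there is such an edge. -/
def missSet (x : HierGroup N) (n : ℕ) : Set (Config N) :=
  (⋃ p, exitSet x n p) ∩ ⋂ p, ((exitSet x n p)ᶜ ∪ deadSet p.2)

/-- The pairs with at least one point in the `n`-ball of the origin. -/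
def edgesTouching (N n : ℕ) : Set (Sym2 (HierGroup N)) :=
  {e | ∃ y z, hdist 0 y ≤ n ∧ s(y, z) = e}

theorem edgesIn_subset_edgesTouching (n : ℕ) :
    (edgesIn n (0 : HierGroup N) : Set (Sym2 (HierGroup N))) ⊆ edgesTouching N n := by
  intro e he
  induction e with
  | _ a b => exact ⟨a, b, (mk_mem_edgesIn.1 he).1, rfl⟩

theorem measurableSet_exitSet (x : HierGroup N) (n : ℕ) (p : HierGroup N × HierGroup N) :
    MeasurableSet[cyl (edgesTouching N n)] (exitSet x n p) := by
  by_cases hp : hdist 0 p.1 ≤ n ∧ n < hdist 0 p.2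
  · have h1 : MeasurableSet[cyl (edgesTouching N n)]
        {ω : Config N | (randomGraph (restrictBall n ω)).Reachable x p.1} :=
      cyl_mono (edgesIn_subset_edgesTouching n) _
        (measurableSet_cyl_of_dependsOn (dependsOn_reachable_restrictBall n x p.1))
    have h2 : MeasurableSet[cyl (edgesTouching N n)] {ω : Config N | ω s(p.1, p.2) = true} :=
      measurable_cyl_apply (I := edgesTouching N n) ⟨p.1, p.2, hp.1, rfl⟩
        (measurableSet_singleton true)
    convert! MeasurableSet.inter h1 h2 using 1
    ext ω
    exact ⟨fun h => h.2.2, fun h => ⟨hp.1, hp.2, h⟩⟩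
  · have : exitSet x n p = ∅ :=
      Set.eq_empty_of_forall_notMem fun ω hω => hp ⟨hω.1, hω.2.1⟩
    rw [this]
    exact @MeasurableSet.empty _ (cyl (edgesTouching N n))

theorem measurableSet_cyl_deadSet (z : HierGroup N) :
    MeasurableSet[cyl (edgesIn (hdist 0 z - 1) z)] (deadSet z) :=
  MeasurableSet.compl (measurableSet_cyl_of_dependsOn (dependsOn_mem_alive _ (by simp)))

theorem measurableSet_missSet (x : HierGroup N) (n : ℕ) : MeasurableSet (missSet x n) := by
  have h1 : ∀ p, MeasurableSet (exitSet x n p) := fun p => cyl_le _ _ (measurableSet_exitSet x n p)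
  have h2 : ∀ z : HierGroup N, MeasurableSet (deadSet z) := fun z =>
    cyl_le _ _ (measurableSet_cyl_deadSet z)
  exact (MeasurableSet.iUnion h1).inter (MeasurableSet.iInter fun p => (h1 p).compl.union (h2 p.2))

theorem disjoint_edgesTouching {n : ℕ} {z : HierGroup N} (hz : n < hdist 0 z) :
    Disjoint (edgesTouching N n) (edgesIn (hdist 0 z - 1) z) := by
  rw [Set.disjoint_left]
  rintro e ⟨a, b, ha, rfl⟩ he
  have h1 := (mk_mem_edgesIn.1 he).1
  have h2 := hdist_le_trans (ha.trans (show n ≤ hdist 0 z - 1 by omega)) (hdist_le_symm h1)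
  omega

theorem measure_missSet_inter_le {c : ℕ → ℝ}
    (hm : ∀ k (x : HierGroup N), 7 / 8 ≤ (percMeasure N c).real {ω | x ∈ alive k ω})
    (x : HierGroup N) (n : ℕ) {E : Set (Config N)}
    (hE : MeasurableSet[cyl (edgesTouching N n)] E) :
    percMeasure N c (missSet x n ∩ E) ≤ ENNReal.ofReal (1 / 8) * percMeasure N c E := by
  refine measure_inter_le_mul_of_cover (cyl_le _) (O := exitSet x n) (D := fun p => deadSet p.2)
    (measurableSet_exitSet x n) (fun p E hE hEp => ?_) Set.inter_subset_left (fun p ω hω => ?_) hE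
  · rcases E.eq_empty_or_nonempty with rfl | ⟨ω, hω⟩
    · simp
    have hz := (hEp hω).2.1
    rw [(Indep_iff _ _ _).1 (indep_cyl c (disjoint_edgesTouching hz)) E _ hE
      (measurableSet_cyl_deadSet p.2), mul_comm]
    gcongr
    rw [← ofReal_measureReal (measure_ne_top _ _)]
    refine ENNReal.ofReal_le_ofReal ?_
    have h1 := hm (hdist 0 p.2 - 1) p.2
    have h2 := probReal_compl_eq_one_sub (μ := percMeasure N c)
      (measurableSet_mem_alive (hdist 0 p.2 - 1) p.2)
    have h3 : deadSet p.2 = {ω : Config N | p.2 ∈ alive (hdist 0 p.2 - 1) ω}ᶜ := rfl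
    rw [h3, h2]
    linarith
  · exact ((Set.mem_iInter.1 hω.1.2 p).resolve_left fun h => h hω.2)

/-- The filtration generated by the pairs in the balls around the origin. -/
def ballFiltration (N : ℕ) [NeZero N] :
    Filtration ℕ (MeasurableSpace.pi : MeasurableSpace (Config N)) where
  seq n := cyl (edgesIn n (0 : HierGroup N))
  mono' _ _ h := cyl_mono (Finset.coe_subset.2
    (edgesIn_subset h (hdist_self (0 : HierGroup N) ▸ Nat.zero_le _)))
  le' _ := cyl_le _

theorem iSup_ballFiltration : ⨆ n, ballFiltration N n = MeasurableSpace.pi := by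
  refine le_antisymm (iSup_le (ballFiltration N).le) (iSup_le fun e => ?_)
  induction e with
  | _ a b =>
    have he : s(a, b) ∈ (edgesIn (max (hdist 0 a) (hdist 0 b)) (0 : HierGroup N) :
        Set (Sym2 (HierGroup N))) := Finset.mem_coe.2 <|
      mk_mem_edgesIn.2 ⟨le_max_left _ _, le_max_right _ _⟩
    exact (measurable_cyl_apply he).comap_le.trans
      (le_iSup (fun n => (ballFiltration N n : MeasurableSpace (Config N))) _)

theorem ae_exists_notMem_missSet {c : ℕ → ℝ}
    (hm : ∀ k (x : HierGroup N), 7 / 8 ≤ (percMeasure N c).real {ω | x ∈ alive k ω}) :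
    ∀ᵐ ω ∂percMeasure N c, ∀ (x : HierGroup N) (n₀ : ℕ), ∃ n, n₀ ≤ n ∧ ω ∉ missSet x n := by
  rw [ae_all_iff]
  intro x
  rw [ae_all_iff]
  intro n₀
  have hW : MeasurableSet (⋂ n, ⋂ (_ : n₀ ≤ n), missSet x n) :=
    MeasurableSet.iInter fun n => MeasurableSet.iInter fun _ => measurableSet_missSet x n
  have h0 := measure_eq_zero_of_inter_le (μ := percMeasure N c) (ballFiltration N)
    iSup_ballFiltration hW (a := 1 / 8) (by norm_num) (by norm_num) (n₀ := n₀) fun n hn E hE => by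
      have hsub : (⋂ n, ⋂ (_ : n₀ ≤ n), missSet x n) ∩ E ⊆ missSet x n ∩ E :=
        Set.inter_subset_inter_left _ (Set.biInter_subset_of_mem (t := missSet x) hn)
      have h1 := (measure_mono hsub).trans (measure_missSet_inter_le hm x n
        (cyl_mono (edgesIn_subset_edgesTouching n) _ hE))
      have h2 := ENNReal.toReal_mono (ENNReal.mul_ne_top ENNReal.ofReal_ne_top
        (measure_ne_top _ _)) h1
      rwa [ENNReal.toReal_mul, ENNReal.toReal_ofReal (by norm_num)] at h2
  filter_upwards [measure_eq_zero_iff_ae_notMem.1 h0] with ω hω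
  by_contra! h
  exact hω (Set.mem_iInter₂.2 h)

/-- Almost surely, the vertices with an infinite cluster form one single cluster, which eventually
occupies at least one eighth of the balls around the origin. -/
theorem ae_infSet_eq_cluster (hN : 2 ≤ N) {c : ℕ → ℝ} (hc : ∀ k, 0 ≤ c (k + 1))
    (hsum : ∀ n, ∑ k ∈ Finset.range n, linkError N c k ≤ 1 / 128) :
    ∀ᵐ ω ∂percMeasure N c, (∃ z ∈ infSet ω, infSet ω = {y | (randomGraph ω).Reachable z y}) ∧
      ∀ᶠ k in atTop, (N : ℝ) ^ k / 8 ≤ count (infSet ω) k 0 := by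
  filter_upwards [ae_eventually_good hN hc hsum,
    ae_exists_notMem_missSet (seven_eighths_le_measure_alive hN hc hsum)] with ω hgood hmiss
  obtain ⟨K, hK⟩ := eventually_atTop.1 hgood
  refine ⟨?_, eventually_atTop.2 ⟨K + 1, fun k hk => ?_⟩⟩
  · obtain ⟨z, hz, hz0⟩ := exists_alive_of_good (hK K le_rfl)
    have hzinf : z ∈ infSet ω := mem_infSet_of_forall_alive hN fun i hi =>
      mem_alive_of_good hK le_rfl hz hz0 hi
    refine ⟨z, hzinf, Set.Subset.antisymm (fun x hx => ?_) fun y hy => ?_⟩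
    · obtain ⟨n, hn, hω⟩ := hmiss x (max K (hdist 0 x))
      obtain ⟨y, w, hy, hw, hr, he⟩ := exists_exit hx (n := n) (by omega)
      have hexit : ω ∈ exitSet x n (y, w) := ⟨hy, hw, hr, he⟩
      -- Some exit ends in an alive point, which belongs to the cluster of `z`.
      have hex : ∃ p : HierGroup N × HierGroup N, ω ∈ exitSet x n p ∧ ω ∉ deadSet p.2 := by
        by_contra! hno
        exact hω ⟨Set.mem_iUnion.2 ⟨(y, w), hexit⟩, Set.mem_iInter.2 fun p => by
          by_cases hp : ω ∈ exitSet x n p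
          exacts [Or.inr (hno p hp), Or.inl hp]⟩
      obtain ⟨⟨y', w'⟩, ⟨hy', hw', hr', he'⟩, hdead⟩ := hex
      simp only at hy' hw' hr' he' hdead
      have halive : w' ∈ alive (hdist 0 w' - 1) ω := not_not.1 hdead
      have hzw : (randomGraph ω).Reachable z w' :=
        reachable_of_good hK le_rfl (show K ≤ hdist 0 w' - 1 by omega) hz hz0 halive (by omega)
      have hadj : (randomGraph ω).Adj y' w' := ⟨by rintro rfl; omega, he'⟩
      exact (hr'.mono (randomGraph_restrictBall_le n ω)).trans hadj.reachable |>.trans hzw.symm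
        |>.symm
    · have : {w | (randomGraph ω).Reachable y w} = {w | (randomGraph ω).Reachable z w} :=
        Set.ext fun w => ⟨fun h => SimpleGraph.Reachable.trans hy h,
          fun h => (SimpleGraph.Reachable.symm hy).trans h⟩
      simp only [infSet, Set.mem_ofPred_eq] at hzinf ⊢
      rwa [this]
  · obtain ⟨j, rfl⟩ : ∃ j, k = j + 1 := ⟨k - 1, by omega⟩
    exact le_count_infSet_of_good hN hK (by omega)

/-- The origin has an infinite cluster with positive probability. -/
theorem measure_zero_mem_infSet_pos (hN : 2 ≤ N) {c : ℕ → ℝ} (hc : ∀ k, 0 ≤ c (k + 1))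
    (hsum : ∀ n, ∑ k ∈ Finset.range n, linkError N c k ≤ 1 / 128) :
    0 < percMeasure N c {ω | (0 : HierGroup N) ∈ infSet ω} := by
  have hsub : ⋂ k, {ω : Config N | 0 ∈ alive k ω} ⊆ {ω | (0 : HierGroup N) ∈ infSet ω} :=
    fun ω hω => mem_infSet_of_forall_alive hN (K := 0) fun k _ => Set.mem_iInter.1 hω k
  refine lt_of_lt_of_le ?_ (measure_mono hsub)
  have hlim := tendsto_measure_iInter_atTop (μ := percMeasure N c)
    (s := fun k => {ω : Config N | 0 ∈ alive k ω})
    (fun k => (measurableSet_mem_alive k 0).nullMeasurableSet)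
    (fun i j hij ω hω => alive_antitone ω hij hω) ⟨0, measure_ne_top _ _⟩
  refine lt_of_lt_of_le (show (0 : ENNReal) < ENNReal.ofReal (7 / 8) by
    rw [ENNReal.ofReal_pos]; norm_num) (ge_of_tendsto' hlim fun k => ?_)
  exact ENNReal.ofReal_le_of_le_toReal (seven_eighths_le_measure_alive hN hc hsum k 0)

end

/-! ### Translation invariance and the density -/

/-- The configuration `ω` seen from the point `a`. -/
def translate (a : HierGroup N) (ω : Config N) : Config N := fun e => ω (e.map (a + ·))

theorem translate_add (a b : HierGroup N) (ω : Config N) :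
    translate (a + b) ω = translate a (translate b ω) := by
  funext e
  simp only [translate, Sym2.map_map]
  congr 2
  funext x
  simp only [Function.comp_apply]
  abel

theorem edgeLength_map_add (a : HierGroup N) (e : Sym2 (HierGroup N)) :
    edgeLength (e.map (a + ·)) = edgeLength e := by
  induction e with
  | _ x y => exact hdist_add_left a x y

theorem measurePreserving_translate (c : ℕ → ℝ) (a : HierGroup N) :
    MeasurePreserving (translate a) (percMeasure N c) (percMeasure N c) := by
  have hinj : Function.Injective (Sym2.map (a + ·) : Sym2 (HierGroup N) → Sym2 (HierGroup N)) :=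
    Sym2.map.injective (add_right_injective a)
  refine ⟨measurable_pi_lambda _ fun e => measurable_pi_apply _, ?_⟩
  refine (Measure.map_infinitePi_infinitePi_of_inj hinj).trans ?_
  simp only [edgeLength_map_add]
  rfl

/-- Translation as an isomorphism of random graphs. -/
def translateIso (a : HierGroup N) (ω : Config N) :
    randomGraph (translate a ω) ≃g randomGraph ω where
  toEquiv := Equiv.addLeft a
  map_rel_iff' := by
    intro x y
    simp [randomGraph, translate]

theorem mem_infSet_translate {a x : HierGroup N} {ω : Config N} :
    x ∈ infSet (translate a ω) ↔ a + x ∈ infSet ω := by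
  have h : {y | (randomGraph ω).Reachable (a + x) y} =
      (a + ·) '' {y | (randomGraph (translate a ω)).Reachable x y} := by
    ext y
    constructor
    · intro hy
      refine ⟨-a + y, ?_, by simp⟩
      refine (translateIso a ω).reachable_iff.1 ?_
      change (randomGraph ω).Reachable (a + x) (a + (-a + y))
      rwa [add_neg_cancel_left]
    · rintro ⟨z, hz, rfl⟩
      exact (translateIso a ω).reachable_iff.2 hz
  simp only [infSet, Set.mem_ofPred_eq]
  rw [h, Set.infinite_image_iff (add_right_injective a).injOn]

/-- The subgroup of the points of the `k`-ball around the origin. -/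
def ballSubgroup (N k : ℕ) : AddSubgroup (HierGroup N) where
  carrier := {x | hdist 0 x ≤ k}
  zero_mem' := by simp
  add_mem' {x y} hx hy := hdist_le_iff.2 fun i hi => by
    rw [Finsupp.add_apply, ← hdist_le_iff.1 hx i hi, ← hdist_le_iff.1 hy i hi]
    simp
  neg_mem' {x} hx := hdist_le_iff.2 fun i hi => by
    rw [Finsupp.neg_apply, ← hdist_le_iff.1 hx i hi]
    simp

theorem ballSubgroup_mono : Monotone (ballSubgroup N) := fun _ _ h _ hx => le_trans hx h

section

variable [NeZero N]

instance (k : ℕ) : Fintype (ballSubgroup N k) :=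
  Fintype.subtype (ballF k 0) fun _ => mem_ballF

theorem avg_ballSubgroup (ω : Config N) (k : ℕ) :
    GroupAverage.avg translate (ballSubgroup N) k
      ({ω : Config N | 0 ∈ infSet ω}.indicator 1) ω = count (infSet ω) k 0 / (N : ℝ) ^ k := by
  classical
  have hcard : Fintype.card (ballSubgroup N k) = N ^ k :=
    (Fintype.subtype_card (p := fun x => x ∈ ballSubgroup N k) (ballF k 0)
      fun _ => mem_ballF).trans (card_ballF k 0)
  have hsum : ∑ a : ballSubgroup N k, ({ω : Config N | 0 ∈ infSet ω}.indicator (1 : Config N → ℝ))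
      (translate a ω) = ∑ a ∈ ballF k 0, if a ∈ infSet ω then (1 : ℝ) else 0 := by
    rw [Finset.sum_subtype (ballF k 0) (p := fun x => x ∈ ballSubgroup N k) fun _ => mem_ballF]
    refine Finset.sum_congr rfl fun a _ => ?_
    simp only [Set.indicator_apply, Set.mem_ofPred_eq, mem_infSet_translate, add_zero,
      Pi.one_apply]
  rw [GroupAverage.avg, hsum, hcard, count, Finset.card_filter, div_eq_inv_mul]
  push_cast
  rfl

theorem infinite_iff_forall_exists_lt_hdist {S : Set (HierGroup N)} :
    S.Infinite ↔ ∀ n : ℕ, ∃ y ∈ S, n < hdist 0 y := by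
  constructor
  · intro h n
    by_contra! hno
    exact h ((ballF n 0).finite_toSet.subset fun y hy => mem_ballF.2 (hno y hy))
  · intro h hfin
    obtain ⟨y, hy, hlt⟩ := h (hfin.toFinset.sup (hdist 0))
    exact absurd (Finset.le_sup (f := hdist 0) (hfin.mem_toFinset.2 hy)) (not_le.2 hlt)

theorem measurableSet_reachable (x y : HierGroup N) :
    MeasurableSet {ω : Config N | (randomGraph ω).Reachable x y} := by
  have : {ω : Config N | (randomGraph ω).Reachable x y} =
      ⋃ n, {ω : Config N | (randomGraph (restrictBall n ω)).Reachable x y} := by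
    ext ω
    rw [Set.mem_iUnion]
    exact reachable_iff_exists_restrictBall
  rw [this]
  exact MeasurableSet.iUnion fun n =>
    measurableSet_of_dependsOn (dependsOn_reachable_restrictBall n x y)

theorem measurableSet_mem_infSet (x : HierGroup N) :
    MeasurableSet {ω : Config N | x ∈ infSet ω} := by
  have : {ω : Config N | x ∈ infSet ω} = ⋂ n : ℕ, ⋃ y : HierGroup N, ⋃ (_ : n < hdist 0 y),
      {ω : Config N | (randomGraph ω).Reachable x y} := by
    ext ω
    simp only [infSet, Set.mem_ofPred_eq, infinite_iff_forall_exists_lt_hdist, Set.mem_iInter,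
      Set.mem_iUnion, exists_prop, and_comm]
  rw [this]
  exact MeasurableSet.iInter fun n => MeasurableSet.iUnion fun y => MeasurableSet.iUnion fun _ =>
    measurableSet_reachable x y

theorem ncard_inter_ball (S : Set (HierGroup N)) (k : ℕ) : (S ∩ ball 0 k).ncard = count S k 0 := by
  classical
  rw [count, ← Set.ncard_coe_finset]
  congr 1
  ext y
  simp [ball, and_comm]

/-- The set of the vertices with an infinite cluster has a density. -/
theorem ae_exists_hasDensity_infSet (c : ℕ → ℝ) :
    ∀ᵐ ω ∂percMeasure N c, ∃ d, HasDensity (infSet ω) d := by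
  classical
  have hbound : ∀ ω, |{ω : Config N | 0 ∈ infSet ω}.indicator (1 : Config N → ℝ) ω| ≤ 1 := by
    intro ω
    rw [Set.indicator_apply]
    split_ifs <;> simp
  have h := GroupAverage.ae_tendsto_avg (T := translate) (H := ballSubgroup N)
    (μ := percMeasure N c) (measurePreserving_translate c) translate_add
    ballSubgroup_mono (measurable_one.indicator (measurableSet_mem_infSet 0)) hbound
  refine h.mono fun ω hω => ?_
  obtain ⟨d, hd⟩ := hω
  have heq : (fun k : ℕ => ((infSet ω ∩ ball 0 k).ncard : ℝ) / (N : ℝ) ^ k) = fun k =>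
      GroupAverage.avg translate (ballSubgroup N) k ({ω : Config N | 0 ∈ infSet ω}.indicator 1) ω :=
    funext fun k => by rw [avg_ballSubgroup, ncard_inter_ball]
  refine ⟨d, ?_⟩
  rw [HasDensity, heq]
  exact hd

/-- Under the hypothesis on the link errors, the percolation cluster is unique and has a density
of at least one eighth. -/
theorem ae_exists_unique_cluster (hN : 2 ≤ N) {c : ℕ → ℝ} (hc : ∀ k, 0 ≤ c (k + 1))
    (hsum : ∀ n, ∑ k ∈ Finset.range n, linkError N c k ≤ 1 / 128) :
    ∀ᵐ ω ∂percMeasure N c, ∃ S : Set (HierGroup N), IsPercolationCluster (randomGraph ω) S ∧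
      (∀ T : Set (HierGroup N), IsPercolationCluster (randomGraph ω) T → T = S) ∧
        ∃ d : ℝ, HasDensity S d ∧ 1 / 8 ≤ d := by
  filter_upwards [ae_infSet_eq_cluster hN hc hsum, ae_exists_hasDensity_infSet c]
    with ω ⟨⟨z, hz, hS⟩, hlow⟩ ⟨d, hd⟩
  have hsupp : ∀ x, ((randomGraph ω).connectedComponentMk x).supp =
      {y | (randomGraph ω).Reachable x y} := fun x => by
    ext y
    rw [SimpleGraph.ConnectedComponent.mem_supp_iff, SimpleGraph.ConnectedComponent.eq]
    exact SimpleGraph.reachable_comm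
  refine ⟨infSet ω, ⟨?_, (randomGraph ω).connectedComponentMk z, ?_⟩, ?_, d, hd, ?_⟩
  · rw [hS]; exact hz
  · rw [hsupp, hS]
  · rintro T ⟨hT, C, rfl⟩
    obtain ⟨x, rfl⟩ := C.exists_rep
    change ((randomGraph ω).connectedComponentMk x).supp.Infinite at hT
    change ((randomGraph ω).connectedComponentMk x).supp = infSet ω
    rw [hsupp] at hT ⊢
    have hx : x ∈ infSet ω := hT
    have hzx : (randomGraph ω).Reachable z x := by rw [hS] at hx; exact hx
    rw [hS]
    exact Set.ext fun y => ⟨fun h => hzx.trans h, fun h => hzx.symm.trans h⟩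
  · refine ge_of_tendsto hd ?_
    filter_upwards [hlow] with k hk
    rw [ncard_inter_ball, le_div_iff₀ (natCast_pow_pos k)]
    linarith

/-! ### The link errors for large `C₂` -/

omit [NeZero N] in
theorem sum_range_one_div_sq_le (n : ℕ) :
    ∑ k ∈ Finset.range n, 1 / ((k : ℝ) + 1) ^ 2 ≤ 2 := by
  suffices h : ∑ k ∈ Finset.range n, 1 / ((k : ℝ) + 1) ^ 2 ≤ 2 - 2 / ((n : ℝ) + 1) by
    have : 0 ≤ 2 / ((n : ℝ) + 1) := by positivity
    linarith
  induction n with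
  | zero => simp
  | succ n ih =>
    rw [Finset.sum_range_succ]
    have h1 : 1 / ((n : ℝ) + 1) ^ 2 ≤ 2 / ((n : ℝ) + 1) - 2 / ((n : ℝ) + 1 + 1) := by
      rw [div_sub_div _ _ (by positivity) (by positivity), div_le_div_iff₀ (by positivity)
        (by positivity)]
      nlinarith [sq_nonneg (n : ℝ), (Nat.cast_nonneg n : (0 : ℝ) ≤ n), pow_pos
        (by positivity : (0 : ℝ) < (n : ℝ) + 1) 2, pow_pos
        (by positivity : (0 : ℝ) < (n : ℝ) + 1) 3]
    push_cast
    linarith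

theorem le_connConst {C₀ C₁ : ℝ} (h₀ : 0 ≤ C₀) (h₁ : 0 ≤ C₁) (C₂ α : ℝ) (k : ℕ) :
    C₂ * ((k : ℝ) + 1) ^ α ≤ connConst C₀ C₁ C₂ α (k + 1) := by
  have : 0 ≤ C₁ * Real.log ((k : ℝ) + 1) :=
    mul_nonneg h₁ (Real.log_nonneg (by have := (Nat.cast_nonneg k : (0 : ℝ) ≤ k); linarith))
  rw [connConst]
  push_cast
  linarith

/-- A stretched exponential decays faster than the inverse square. -/
theorem exp_neg_mul_rpow_le {α : ℝ} (hα : 0 < α) {t : ℝ} (ht : 1 ≤ t) (k : ℕ) :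
    Real.exp (-(t * ((k : ℝ) + 1) ^ α)) ≤
      (⌈2 / α⌉₊.factorial : ℝ) / t * (1 / ((k : ℝ) + 1) ^ 2) := by
  set j := ⌈2 / α⌉₊ with hj
  have hj1 : 1 ≤ j := Nat.one_le_ceil_iff.2 (by positivity)
  have hk1 : (1 : ℝ) ≤ (k : ℝ) + 1 := by have := (Nat.cast_nonneg k : (0 : ℝ) ≤ k); linarith
  have hαj : 2 ≤ α * j := by
    have := Nat.le_ceil (2 / α)
    rw [div_le_iff₀ hα] at this
    linarith
  have hpow : ((k : ℝ) + 1) ^ 2 ≤ (((k : ℝ) + 1) ^ α) ^ j := by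
    rw [← Real.rpow_natCast (((k : ℝ) + 1) ^ α), ← Real.rpow_mul (by positivity),
      ← Real.rpow_two]
    exact Real.rpow_le_rpow_of_exponent_le hk1 hαj
  have ht' : t ≤ t ^ j := le_self_pow₀ ht (by omega)
  have hexp := Real.pow_div_factorial_le_exp (t * ((k : ℝ) + 1) ^ α) (by positivity) j
  have hle : t * ((k : ℝ) + 1) ^ 2 ≤ (t * ((k : ℝ) + 1) ^ α) ^ j := by
    rw [mul_pow]
    exact mul_le_mul ht' hpow (by positivity) (by positivity)
  have hfac : (0 : ℝ) < j.factorial := by exact_mod_cast j.factorial_pos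
  rw [Real.exp_neg, div_mul_div_comm, mul_one]
  rw [inv_le_comm₀ (Real.exp_pos _) (by positivity), inv_div]
  exact (div_le_div_of_nonneg_right hle hfac.le).trans hexp

/-- The constant is chosen so that, by `exp_neg_mul_rpow_le` with `t = C₂ / (64 * N ^ 2)`, the
`k`-th link error is at most `1 / (256 * (k + 1) ^ 2)`. -/
theorem sum_linkError_le {α : ℝ} (hα : 0 < α) {C₀ C₁ C₂ : ℝ} (h₀ : 0 ≤ C₀) (h₁ : 0 ≤ C₁)
    (h₂ : 64 * (N : ℝ) ^ 2 * (256 * (N : ℝ) ^ 2 * (⌈2 / α⌉₊.factorial : ℝ)) ≤ C₂) (n : ℕ) :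
    ∑ k ∈ Finset.range n, linkError N (connConst C₀ C₁ C₂ α) k ≤ 1 / 128 := by
  have hN : (1 : ℝ) ≤ N := by exact_mod_cast NeZero.one_le
  have hN2 : (1 : ℝ) ≤ (N : ℝ) ^ 2 := one_le_pow₀ hN
  set J : ℝ := (⌈2 / α⌉₊.factorial : ℝ) with hJ
  have hJ1 : 1 ≤ J := by
    rw [hJ]
    exact_mod_cast Nat.succ_le_of_lt (Nat.factorial_pos _)
  set t : ℝ := C₂ / (64 * (N : ℝ) ^ 2) with ht
  have htJ : 256 * (N : ℝ) ^ 2 * J ≤ t := by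
    rw [ht, le_div_iff₀ (by positivity)]
    linarith
  have ht1 : 1 ≤ t := by nlinarith
  have hterm : ∀ k, linkError N (connConst C₀ C₁ C₂ α) k ≤ 1 / 256 * (1 / ((k : ℝ) + 1) ^ 2) := by
    intro k
    have h1 : Real.exp (-(connConst C₀ C₁ C₂ α (k + 1) / (64 * (N : ℝ) ^ 2))) ≤
        Real.exp (-(t * ((k : ℝ) + 1) ^ α)) := by
      rw [Real.exp_le_exp, neg_le_neg_iff, ht, div_mul_eq_mul_div]
      exact div_le_div_of_nonneg_right (le_connConst h₀ h₁ C₂ α k) (by positivity)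
    have h2 := h1.trans (exp_neg_mul_rpow_le hα ht1 k)
    have h3 : (N : ℝ) ^ 2 * (J / t) ≤ 1 / 256 := by
      rw [← mul_div_assoc, div_le_div_iff₀ (by linarith) (by norm_num)]
      linarith
    calc linkError N (connConst C₀ C₁ C₂ α) k
        ≤ (N : ℝ) ^ 2 * (J / t * (1 / ((k : ℝ) + 1) ^ 2)) :=
          mul_le_mul_of_nonneg_left h2 (by positivity)
      _ = (N : ℝ) ^ 2 * (J / t) * (1 / ((k : ℝ) + 1) ^ 2) := by ring
      _ ≤ 1 / 256 * (1 / ((k : ℝ) + 1) ^ 2) := mul_le_mul_of_nonneg_right h3 (by positivity)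
  have h4 := sum_range_one_div_sq_le n
  calc ∑ k ∈ Finset.range n, linkError N (connConst C₀ C₁ C₂ α) k
      ≤ ∑ k ∈ Finset.range n, 1 / 256 * (1 / ((k : ℝ) + 1) ^ 2) :=
        Finset.sum_le_sum fun k _ => hterm k
    _ ≤ 1 / 128 := by rw [← Finset.mul_sum]; linarith

end

end HierarchicalPercolation

end

theorem theorem2p1 (N : ℕ) (hN : 2 ≤ N) (α : ℝ) (hα : 0 < α) :
    ∃ Cstar : ℝ, ∀ C₂ : ℝ, Cstar ≤ C₂ → 0 < C₂ →
      ∃ ε : ℝ, 0 < ε ∧ ∀ C₀ C₁ : ℝ, 0 ≤ C₀ → 0 ≤ C₁ →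
        (∀ᵐ ω ∂(HierarchicalPercolation.percMeasure N
              (HierarchicalPercolation.connConst C₀ C₁ C₂ α)),
          ∃ S : Set (HierarchicalPercolation.HierGroup N),
            HierarchicalPercolation.IsPercolationCluster
              (HierarchicalPercolation.randomGraph ω) S ∧
            (∀ T : Set (HierarchicalPercolation.HierGroup N),
              HierarchicalPercolation.IsPercolationCluster
                (HierarchicalPercolation.randomGraph ω) T → T = S) ∧
            ∃ d : ℝ, HierarchicalPercolation.HasDensity S d ∧ ε ≤ d) ∧
        0 < HierarchicalPercolation.percMeasure N
              (HierarchicalPercolation.connConst C₀ C₁ C₂ α)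
            {ω | ∃ S : Set (HierarchicalPercolation.HierGroup N),
              HierarchicalPercolation.IsPercolationCluster
                (HierarchicalPercolation.randomGraph ω) S ∧ 0 ∈ S} := by
  have : NeZero N := ⟨by omega⟩
  refine ⟨64 * (N : ℝ) ^ 2 * (256 * (N : ℝ) ^ 2 * (⌈2 / α⌉₊.factorial : ℝ)), fun C₂ hC hC₂ =>
    ⟨1 / 8, by norm_num, fun C₀ C₁ h₀ h₁ => ?_⟩⟩
  have hc : ∀ k, 0 ≤ HierarchicalPercolation.connConst C₀ C₁ C₂ α (k + 1) := fun k =>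
    le_trans (by positivity) (HierarchicalPercolation.le_connConst h₀ h₁ C₂ α k)
  have hsum := HierarchicalPercolation.sum_linkError_le (N := N) hα h₀ h₁ hC
  refine ⟨HierarchicalPercolation.ae_exists_unique_cluster hN hc hsum,
    (HierarchicalPercolation.measure_zero_mem_infSet_pos hN hc hsum).trans_le
      (measure_mono fun ω hω => ?_)⟩
  refine ⟨((HierarchicalPercolation.randomGraph ω).connectedComponentMk 0).supp, ⟨?_, _, rfl⟩,
    rfl⟩
  refine Set.Infinite.mono (fun y hy => ?_) hω
  rw [SimpleGraph.ConnectedComponent.mem_supp_iff, SimpleGraph.ConnectedComponent.eq]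
  exact SimpleGraph.Reachable.symm hy
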